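/- Let $h\in\mathbb C$, $h\neq 0$, and let $I$ be a linearly ordered index set. Let $H_I$ be the unital complex algebra generated by $x_i,y_i$ ($i\in I$) with relations $x_iy_i=y_ix_i+hy_i^2$ and, for $i<j$, $$x_jy_i=y_ix_j+hy_iy_j,\quad y_jx_i=x_iy_j-hy_iy_j,\quad y_jy_i=y_iy_j,\quad x_jx_i=x_ix_j-hx_iy_j+hy_ix_j+h^2y_iy_j .$$ Let $E,F,H$ be the linear operators on $H_I$ with $E1=F1=H1=0$, $Ex_i=0$, $Ey_i=x_i$, $Fx_i=y_i$, $Fy_i=0$, $Hx_i=x_i$, $Hy_i=-y_i$ and $E(ab)=E(a)e^{-hF}(b)+e^{hF}(a)E(b)$, $F(ab)=F(a)b+aF(b)$, $H(ab)=H(a)e^{-hF}(b)+e^{hF}(a)H(b)$. Call $v\in H_I$ invariant if $E(v)=F(v)=H(v)=0$; write $H_I^{Inv}$ for the algebra of invariant elements, and $(ij):=x_iy_j-y_ix_j-hy_iy_j$. Fix $0\in I$, put $x=x_0$, $y=y_0$, and let $H_{I\setminus\{0\}}$ be the subalgebra generated by the $x_i,y_i$ with $i\ne 0$. An $n$-form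 is an element $0\neq f\in H_I^{Inv}$ with $f=\sum_{i=0}^n\binom ni x^{n-i}y^iA_i$, $A_i\in H_{I\setminus\{0\}}$; the $A_i$ are the coefficients of $f$. Theorem 9 (symbolic method). Let $n,k\ge 0$, let $1<2<\dots<k$ be indices in $I\setminus\{0\}$, and let $d\in H_I^{Inv}$ be homogeneous of degree $n$ with respect to the indices $1,\dots,k$, i.e. a linear combination of words in the generators in which each of $1,\dots,k$ occurs exactly $n$ times and no other index occurs. For $1\le j\le k$ let $A^{(j)}_0,\dots,A^{(j)}_n$ be the coefficients of the $n$-form $(0j)^n$; they have the shape $$A^{(j)}_i=(-1)^ix_j^iy_j^{n-i}+\sum_{l=1}^{i}\gamma_{il}h^l\,x_j^{i-l}y_j^{n-i+l}$$ with numbers $\gamma_{il}$ not depending on $j$. Write $d$ as a linear combination of the monomials $x_1^{n-i_1}y_1^{i_1}\cdots x_k^{n-i_k}y_k^{i_k}$, and in these replace successively, for $i=n,n-1,\dots,0$, each $x_j^{i}y_j^{n-i}$ by $(-1)^i\bigl(A^{(j)}_i-\sum_{l=1}^i\gamma_{il}h^l\,x_j^{i-l}y_j^{n-i+l}\bigr)$,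 where the $A^{(j)}_i$ are treated as symbols. This procedure can be carried out, it yields uniquely determined complex numbers $c_{i_1,\dots,i_k}$ ($0\le i_1,\dots,i_k\le n$), and $$d=\sum c_{i_1,\dots,i_k}A^{(1)}_{i_1}\cdots A^{(k)}_{i_k}.$$ For every $n$-form $f\in H_I$ with coefficients $A_0,\dots,A_n$ the expression, of degree $k$ in the coefficients, $$\mathcal I=\sum c_{i_1,\dots,i_k}A_{i_1}\cdots A_{i_k}$$ is an invariant of $f$, i.e. it is an element of $H_{I\setminus\{0\}}$ with $E(\mathcal I)=F(\mathcal I)=H(\mathcal I)=0$. -/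

import Mathlib

namespace NCForms

/-- The generators `x i`, `y i` for `i` in the index set. -/
inductive Coord (I : Type*) where
  | x (i : I) : Coord I
  | y (i : I) : Coord I

/-- The index of a generator. -/
def Coord.index {I : Type*} : Coord I → I
  | .x i => i
  | .y i => i

/-- The free complex algebra on the generators. -/
abbrev Free (I : Type*) := FreeAlgebra ℂ (Coord I)

/-- The free generator `x i`. -/
def fx {I : Type*} (i : I) : Free I := FreeAlgebra.ι ℂ (Coord.x i)

/-- The free generator `y i`. -/
def fy {I : Type*} (i : I) : Free I := FreeAlgebra.ι ℂ (Coord.y i)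

/-- The defining quadratic relations. -/
inductive Rel (I : Type*) [LinearOrder I] (h : ℂ) : Free I → Free I → Prop
  | xy (i : I) : Rel I h (fx i * fy i) (fy i * fx i + h • (fy i * fy i))
  | xjyi (i j : I) (hij : i < j) : Rel I h (fx j * fy i) (fy i * fx j + h • (fy i * fy j))
  | yjxi (i j : I) (hij : i < j) : Rel I h (fy j * fx i) (fx i * fy j - h • (fy i * fy j))
  | yjyi (i j : I) (hij : i < j) : Rel I h (fy j * fy i) (fy i * fy j)
  | xjxi (i j : I) (hij : i < j) : Rel I h (fx j * fx i)
      (fx i * fx j - h • (fx i * fy j) + h • (fy i * fx j) + h ^ 2 • (fy i * fy j))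

/-- The algebra `H_I` of noncommutative homogeneous coordinates. -/
def HAlg (I : Type*) [LinearOrder I] (h : ℂ) : Type _ := RingQuot (Rel I h)

section Algebra

variable {I : Type*} [LinearOrder I] {h : ℂ}

noncomputable instance : Ring (HAlg I h) := inferInstanceAs (Ring (RingQuot (Rel I h)))

noncomputable instance : Algebra ℂ (HAlg I h) :=
  inferInstanceAs (Algebra ℂ (RingQuot (Rel I h)))

/-- The quotient map from the free algebra. -/
noncomputable def HAlg.mk : Free I →ₐ[ℂ] HAlg I h := RingQuot.mkAlgHom ℂ (Rel I h)

/-- The image in `H_I` of a generator. -/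
noncomputable def HAlg.gen (c : Coord I) : HAlg I h := HAlg.mk (FreeAlgebra.ι ℂ c)

/-- The generator `x i` of `H_I`. -/
noncomputable def HAlg.x (i : I) : HAlg I h := HAlg.gen (Coord.x i)

/-- The generator `y i` of `H_I`. -/
noncomputable def HAlg.y (i : I) : HAlg I h := HAlg.gen (Coord.y i)

theorem HAlg.mk_fx (i : I) : HAlg.mk (h := h) (fx i) = HAlg.x i := rfl

theorem HAlg.mk_fy (i : I) : HAlg.mk (h := h) (fy i) = HAlg.y i := rfl

theorem HAlg.mk_rel {a b : Free I} (r : Rel I h a b) :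
    HAlg.mk (h := h) a = HAlg.mk b := RingQuot.mkAlgHom_rel ℂ r

/-- The defining relations for two families `X`, `Y` of elements of an algebra. -/
structure Satisfies (h : ℂ) {B : Type*} [Ring B] [Algebra ℂ B] (X Y : I → B) : Prop where
  xy (i : I) : X i * Y i = Y i * X i + h • (Y i * Y i)
  xjyi (i j : I) (hij : i < j) : X j * Y i = Y i * X j + h • (Y i * Y j)
  yjxi (i j : I) (hij : i < j) : Y j * X i = X i * Y j - h • (Y i * Y j)
  yjyi (i j : I) (hij : i < j) : Y j * Y i = Y i * Y j
  xjxi (i j : I) (hij : i < j) : X j * X i =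
    X i * X j - h • (X i * Y j) + h • (Y i * X j) + h ^ 2 • (Y i * Y j)

/-- The generators of `H_I` satisfy the relations. -/
theorem HAlg.satisfies : Satisfies h (HAlg.x (I := I) (h := h)) HAlg.y where
  xy i := by simpa [mk_fx, mk_fy] using HAlg.mk_rel (Rel.xy (h := h) i)
  xjyi i j hij := by simpa [mk_fx, mk_fy] using HAlg.mk_rel (Rel.xjyi (h := h) i j hij)
  yjxi i j hij := by simpa [mk_fx, mk_fy] using HAlg.mk_rel (Rel.yjxi (h := h) i j hij)
  yjyi i j hij := by simpa [mk_fx, mk_fy] using HAlg.mk_rel (Rel.yjyi (h := h) i j hij)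
  xjxi i j hij := by simpa [mk_fx, mk_fy] using HAlg.mk_rel (Rel.xjxi (h := h) i j hij)

/-- The value of a family of pairs on the generators. -/
def onCoord {B : Type*} (X Y : I → B) : Coord I → B
  | .x i => X i
  | .y i => Y i

/-- The universal property of `H_I`. -/
noncomputable def HAlg.lift {B : Type*} [Ring B] [Algebra ℂ B] (X Y : I → B)
    (hXY : Satisfies h X Y) : HAlg I h →ₐ[ℂ] B :=
  RingQuot.liftAlgHom ℂ ⟨FreeAlgebra.lift ℂ (onCoord X Y), by
    intro a b r
    cases r with
    | xy i => simpa [fx, fy, onCoord] using hXY.xy i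
    | xjyi i j hij => simpa [fx, fy, onCoord] using hXY.xjyi i j hij
    | yjxi i j hij => simpa [fx, fy, onCoord] using hXY.yjxi i j hij
    | yjyi i j hij => simpa [fx, fy, onCoord] using hXY.yjyi i j hij
    | xjxi i j hij => simpa [fx, fy, onCoord] using hXY.xjxi i j hij⟩

theorem HAlg.lift_gen {B : Type*} [Ring B] [Algebra ℂ B] (X Y : I → B)
    (hXY : Satisfies h X Y) (c : Coord I) : HAlg.lift X Y hXY (HAlg.gen c) = onCoord X Y c := by
  unfold HAlg.lift HAlg.gen HAlg.mk
  exact (RingQuot.liftAlgHom_mkAlgHom_apply ..).trans (FreeAlgebra.lift_ι_apply ..)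

@[simp] theorem HAlg.lift_x {B : Type*} [Ring B] [Algebra ℂ B] (X Y : I → B)
    (hXY : Satisfies h X Y) (i : I) : HAlg.lift X Y hXY (HAlg.x i) = X i :=
  HAlg.lift_gen X Y hXY _

@[simp] theorem HAlg.lift_y {B : Type*} [Ring B] [Algebra ℂ B] (X Y : I → B)
    (hXY : Satisfies h X Y) (i : I) : HAlg.lift X Y hXY (HAlg.y i) = Y i :=
  HAlg.lift_gen X Y hXY _

/-- An induction principle for `H_I`. -/
theorem HAlg.induction {P : HAlg I h → Prop} (scalar : ∀ z : ℂ, P (algebraMap ℂ _ z))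
    (hx : ∀ i, P (HAlg.x i)) (hy : ∀ i, P (HAlg.y i))
    (mul : ∀ a b, P a → P b → P (a * b)) (add : ∀ a b, P a → P b → P (a + b))
    (a : HAlg I h) : P a := by
  obtain ⟨b, rfl⟩ := RingQuot.mkAlgHom_surjective ℂ (Rel I h) a
  induction b using FreeAlgebra.induction with
  | grade0 z => rw [AlgHom.commutes]; exact scalar z
  | grade1 c => cases c with
    | x i => exact hx i
    | y i => exact hy i
  | mul a b ha hb => rw [map_mul]; exact mul _ _ ha hb
  | add a b ha hb => rw [map_add]; exact add _ _ ha hb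

/-- An upper triangular matrix with entries in `H_I`. -/
noncomputable def upper (a b c : HAlg I h) : Matrix (Fin 2) (Fin 2) (HAlg I h) := !![a, b; 0, c]

/-- Two twisting maps and a skew derivation, given by their values on the generators, preserve
the relations: the matrix form of this fact. -/
theorem satisfies_upper (s t α β γ δ : ℂ)
    (hF : (s = 0 ∧ t = 0 ∧ α = 0 ∧ γ = 1 ∧ β = 0 ∧ δ = 0) ∨
      (s = h ∧ t = -h ∧ α = 0 ∧ γ = 0 ∧ β = 1 ∧ δ = 0) ∨
      (s = h ∧ t = -h ∧ α = 1 ∧ γ = 0 ∧ β = 0 ∧ δ = -1)) :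
    Satisfies h
      (fun i : I => upper (HAlg.x (h := h) i + s • HAlg.y i) (α • HAlg.x i + γ • HAlg.y i)
        (HAlg.x i + t • HAlg.y i))
      (fun i : I => upper (HAlg.y i) (β • HAlg.x i + δ • HAlg.y i) (HAlg.y i)) := by
  have S := HAlg.satisfies (I := I) (h := h)
  constructor
  · intro i
    have h1 := S.xy i
    ext a b
    fin_cases a <;> fin_cases b <;>
    simp only [upper, Matrix.mul_apply, Fin.sum_univ_two, Matrix.add_apply, Matrix.smul_apply,
      Matrix.of_apply, Matrix.cons_val', Matrix.cons_val_zero, Matrix.cons_val_one,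
      Fin.zero_eta, Fin.mk_one, Fin.isValue, Matrix.cons_val_fin_one,
      mul_add, add_mul, smul_mul_assoc, mul_smul_comm, h1, mul_zero, zero_mul,
      add_zero, zero_add, smul_zero] <;>
    rcases hF with ⟨rfl, rfl, rfl, rfl, rfl, rfl⟩ | ⟨rfl, rfl, rfl, rfl, rfl, rfl⟩ |
      ⟨rfl, rfl, rfl, rfl, rfl, rfl⟩ <;> module
  all_goals
    intro i j hij
    have h1 := S.xjyi i j hij
    have h2 := S.yjxi i j hij
    have h3 := S.yjyi i j hij
    have h4 := S.xjxi i j hij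
    have h5 : HAlg.x (h := h) i * HAlg.y j = HAlg.y j * HAlg.x i + h • (HAlg.y i * HAlg.y j) := by
      rw [h2]; module
    ext a b
    fin_cases a <;> fin_cases b <;>
    simp only [upper, Matrix.mul_apply, Fin.sum_univ_two, Matrix.add_apply, Matrix.sub_apply,
      Matrix.smul_apply,
      Matrix.of_apply, Matrix.cons_val', Matrix.cons_val_zero, Matrix.cons_val_one,
      Fin.zero_eta, Fin.mk_one, Fin.isValue, Matrix.cons_val_fin_one,
      mul_add, add_mul, smul_mul_assoc, mul_smul_comm, h1, h3, h4, h5, mul_zero, zero_mul,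
      add_zero, zero_add, smul_zero, sub_zero] <;>
    rcases hF with ⟨rfl, rfl, rfl, rfl, rfl, rfl⟩ | ⟨rfl, rfl, rfl, rfl, rfl, rfl⟩ |
      ⟨rfl, rfl, rfl, rfl, rfl, rfl⟩ <;> module

/-- The algebra endomorphism `x i ↦ x i + t y i`, `y i ↦ y i`. It is the operator `e^{tF}`,
see `expF_eq_sum`. -/
noncomputable def expF (t : ℂ) : HAlg I h →ₐ[ℂ] HAlg I h :=
  HAlg.lift (fun i => HAlg.x i + t • HAlg.y i) HAlg.y (by
    have S := HAlg.satisfies (I := I) (h := h)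
    constructor
    · intro i
      have h1 := S.xy i
      simp only [mul_add, add_mul, smul_mul_assoc, mul_smul_comm, h1]
      module
    all_goals
      intro i j hij
      have h1 := S.xjyi i j hij
      have h2 := S.yjxi i j hij
      have h3 := S.yjyi i j hij
      have h4 := S.xjxi i j hij
      have h5 : HAlg.x (h := h) i * HAlg.y j =
          HAlg.y j * HAlg.x i + h • (HAlg.y i * HAlg.y j) := by rw [h2]; module
      simp only [mul_add, add_mul, smul_mul_assoc, mul_smul_comm, h1, h3, h4, h5]
      try module)

/-- The matrices `!![a, F a; 0, a]`. -/
noncomputable def matF : HAlg I h →ₐ[ℂ] Matrix (Fin 2) (Fin 2) (HAlg I h) :=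
  HAlg.lift _ _ (satisfies_upper 0 0 0 0 1 0 (by simp))

/-- The matrices `!![e^{hF} a, E a; 0, e^{-hF} a]`. -/
noncomputable def matE : HAlg I h →ₐ[ℂ] Matrix (Fin 2) (Fin 2) (HAlg I h) :=
  HAlg.lift _ _ (satisfies_upper h (-h) 0 1 0 0 (by simp))

/-- The matrices `!![e^{hF} a, H a; 0, e^{-hF} a]`. -/
noncomputable def matH : HAlg I h →ₐ[ℂ] Matrix (Fin 2) (Fin 2) (HAlg I h) :=
  HAlg.lift _ _ (satisfies_upper h (-h) 1 0 0 (-1) (by simp))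

/-- The upper right entry of a matrix valued homomorphism. -/
noncomputable def corner (φ : HAlg I h →ₐ[ℂ] Matrix (Fin 2) (Fin 2) (HAlg I h)) :
    HAlg I h →ₗ[ℂ] HAlg I h where
  toFun a := φ a 0 1
  map_add' a b := by simp
  map_smul' z a := by simp

/-- The action of the generator `E` of the quantum group on `H_I`. -/
noncomputable def opE : HAlg I h →ₗ[ℂ] HAlg I h := corner matE

/-- The action of the generator `F` of the quantum group on `H_I`. -/
noncomputable def opF : HAlg I h →ₗ[ℂ] HAlg I h := corner matF

/-- The action of the generator `H` of the quantum group on `H_I`. -/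
noncomputable def opH : HAlg I h →ₗ[ℂ] HAlg I h := corner matH

theorem mat_entries (φ : HAlg I h →ₐ[ℂ] Matrix (Fin 2) (Fin 2) (HAlg I h)) (s t : ℂ)
    (hx : ∀ i, φ (HAlg.x i) 0 0 = expF s (HAlg.x i) ∧ φ (HAlg.x i) 1 0 = 0 ∧
      φ (HAlg.x i) 1 1 = expF t (HAlg.x i))
    (hy : ∀ i, φ (HAlg.y i) 0 0 = expF s (HAlg.y i) ∧ φ (HAlg.y i) 1 0 = 0 ∧
      φ (HAlg.y i) 1 1 = expF t (HAlg.y i)) (a : HAlg I h) :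
    φ a 0 0 = expF s a ∧ φ a 1 0 = 0 ∧ φ a 1 1 = expF t a := by
  induction a using HAlg.induction with
  | scalar z => simp [Matrix.algebraMap_matrix_apply]
  | hx i => exact hx i
  | hy i => exact hy i
  | mul a b ha hb =>
    simp [Matrix.mul_apply, Fin.sum_univ_two, ha.1, ha.2.1, ha.2.2, hb.1, hb.2.1, hb.2.2]
  | add a b ha hb => simp [ha.1, ha.2.1, ha.2.2, hb.1, hb.2.1, hb.2.2]

theorem expF_zero (a : HAlg I h) : expF 0 a = a := by
  induction a using HAlg.induction with
  | scalar z => simp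
  | hx i => simp [expF]
  | hy i => simp [expF]
  | mul a b ha hb => rw [map_mul, ha, hb]
  | add a b ha hb => rw [map_add, ha, hb]

theorem opE_mul (a b : HAlg I h) :
    opE (a * b) = opE a * expF (-h) b + expF h a * opE b := by
  have A := mat_entries (matE (I := I) (h := h)) h (-h)
    (fun i => by simp [matE, upper, expF]) (fun i => by simp [matE, upper, expF])
  simp [opE, corner, Matrix.mul_apply, Fin.sum_univ_two, (A a).1, (A b).2.2, add_comm]

theorem opF_mul (a b : HAlg I h) : opF (a * b) = opF a * b + a * opF b := by
  have A := mat_entries (matF (I := I) (h := h)) 0 0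
    (fun i => by simp [matF, upper, expF]) (fun i => by simp [matF, upper, expF])
  simp [opF, corner, Matrix.mul_apply, Fin.sum_univ_two, (A a).1, (A b).2.2, add_comm, expF_zero]

theorem opH_mul (a b : HAlg I h) :
    opH (a * b) = opH a * expF (-h) b + expF h a * opH b := by
  have A := mat_entries (matH (I := I) (h := h)) h (-h)
    (fun i => by simp [matH, upper, expF]) (fun i => by simp [matH, upper, expF])
  simp [opH, corner, Matrix.mul_apply, Fin.sum_univ_two, (A a).1, (A b).2.2, add_comm]

/-- The values of the three operators on `1`. -/
theorem op_one : opE (1 : HAlg I h) = 0 ∧ opF (1 : HAlg I h) = 0 ∧ opH (1 : HAlg I h) = 0 := by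
  simp [opE, opF, opH, corner]

/-- The values of the three operators on the generators. -/
theorem op_generators (i : I) :
    opE (HAlg.x (h := h) i) = 0 ∧ opE (HAlg.y (h := h) i) = HAlg.x i ∧
    opF (HAlg.x (h := h) i) = HAlg.y i ∧ opF (HAlg.y (h := h) i) = 0 ∧
    opH (HAlg.x (h := h) i) = HAlg.x i ∧ opH (HAlg.y (h := h) i) = -HAlg.y i := by
  simp [opE, opF, opH, corner, matE, matF, matH, upper]

theorem satisfies_poly (t : ℂ) :
    Satisfies h
      (fun i : I => Polynomial.monomial 0 (HAlg.x (h := h) i) +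
        Polynomial.monomial 1 (t • HAlg.y (h := h) i))
      (fun i : I => Polynomial.monomial 0 (HAlg.y (h := h) i)) := by
  have S := HAlg.satisfies (I := I) (h := h)
  constructor
  · intro i
    have h1 := S.xy i
    simp only [mul_add, add_mul, Polynomial.monomial_mul_monomial, smul_mul_assoc,
      mul_smul_comm, h1, map_add, zero_add, add_zero,
      ← Polynomial.smul_monomial]
    module
  all_goals
    intro i j hij
    have h1 := S.xjyi i j hij
    have h2 := S.yjxi i j hij
    have h3 := S.yjyi i j hij
    have h4 := S.xjxi i j hij
    have h5 : HAlg.x (h := h) i * HAlg.y j =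
        HAlg.y j * HAlg.x i + h • (HAlg.y i * HAlg.y j) := by rw [h2]; module
    simp only [mul_add, add_mul, Polynomial.monomial_mul_monomial, smul_mul_assoc,
      mul_smul_comm, h1, h3, h4, h5, map_add, map_sub, zero_add, add_zero,
      ← Polynomial.smul_monomial]
    try module

/-- `expF t` is the exponential series of `tF`, which is a finite sum on each element. -/
theorem expF_eq_sum (t : ℂ) (a : HAlg I h) : ∃ N : ℕ, ∀ M ≥ N,
    expF t a = ∑ m ∈ Finset.range M, (t ^ m / (m.factorial : ℂ)) • (opF^[m]) a := by
  let Φ := HAlg.lift _ _ (satisfies_poly (I := I) (h := h) t)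
  have hev : ∀ a, (Φ a).eval 1 = expF t a := by
    intro a
    induction a using HAlg.induction with
    | scalar z => simp [Polynomial.algebraMap_apply]
    | hx i => simp [Φ, expF]
    | hy i => simp [Φ, expF]
    | mul a b ha hb =>
      rw [map_mul, map_mul, ← ha, ← hb]
      exact Polynomial.eval₂_mul_noncomm _ _ (fun k => by simp)
    | add a b ha hb => rw [map_add, map_add, Polynomial.eval_add, ha, hb]
  have hder : ∀ a, Polynomial.derivative (Φ a) = t • Φ (opF a) := by
    intro a
    induction a using HAlg.induction with
    | scalar z =>
      rw [Algebra.algebraMap_eq_smul_one]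
      simp only [map_smul, map_one, Polynomial.derivative_smul, Polynomial.derivative_one,
        smul_zero, op_one.2.1, map_zero]
    | hx i =>
      rw [(op_generators i).2.2.1]
      simp [Φ, ← Polynomial.C_mul_X_eq_monomial, Polynomial.smul_C]
    | hy i =>
      rw [(op_generators i).2.2.2.1]
      simp [Φ]
    | mul a b ha hb =>
      rw [opF_mul, map_mul, Polynomial.derivative_mul, ha, hb]
      simp
    | add a b ha hb => simp [ha, hb]
  have hcoeff : ∀ (m : ℕ) (a : HAlg I h), (m.factorial : ℂ) • (Φ a).coeff m =
      t ^ m • (opF^[m]) a := by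
    intro m
    induction m with
    | zero =>
      intro a
      simp only [Nat.factorial_zero, Nat.cast_one, one_smul, pow_zero, Function.iterate_zero, id]
      induction a using HAlg.induction with
      | scalar z => simp [Polynomial.algebraMap_apply]
      | hx i => simp [Φ, Polynomial.coeff_monomial]
      | hy i => simp [Φ]
      | mul a b ha hb => rw [map_mul, Polynomial.mul_coeff_zero, ha, hb]
      | add a b ha hb => rw [map_add, Polynomial.coeff_add, ha, hb]
    | succ m ih =>
      intro a
      have h1 := congrArg (fun p => p.coeff m) (hder a)
      simp only [Polynomial.coeff_derivative, Polynomial.coeff_smul] at h1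
      have h2 : ((m : ℂ) + 1) • (Φ a).coeff (m + 1) = t • (Φ (opF a)).coeff m := by
        rw [← h1, Algebra.smul_def, map_add, map_natCast, map_one]
        exact ((Nat.cast_commute m _).add_left (Commute.one_left _)).eq
      rw [Function.iterate_succ_apply, pow_succ', mul_smul, ← ih, smul_comm t, ← h2,
        Nat.factorial_succ]
      push_cast
      module
  refine ⟨(Φ a).natDegree + 1, fun M hM => ?_⟩
  rw [← hev, Polynomial.eval_eq_sum_range' (n := M) (by omega)]
  refine Finset.sum_congr rfl fun m _ => ?_
  have hm : (m.factorial : ℂ) ≠ 0 := by exact_mod_cast m.factorial_ne_zero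
  rw [one_pow, mul_one, div_eq_inv_mul, mul_smul, ← hcoeff, smul_smul, inv_mul_cancel₀ hm,
    one_smul]

/-- Invariant elements of `H_I`. -/
def IsInvariant (v : HAlg I h) : Prop := opE v = 0 ∧ opF v = 0 ∧ opH v = 0

/-- The bracket symbol `(i j)`. -/
noncomputable def bracket (i j : I) : HAlg I h :=
  HAlg.x i * HAlg.y j - HAlg.y i * HAlg.x j - h • (HAlg.y i * HAlg.y j)

/-- The subalgebra of `H_I` generated by the `x i`, `y i` with `i ≠ o`. -/
noncomputable def without (h : ℂ) (o : I) : Subalgebra ℂ (HAlg I h) :=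
  Algebra.adjoin ℂ {a | ∃ c : Coord I, c.index ≠ o ∧ a = HAlg.gen c}

/-- `f` has the (right, binomially normalized) coefficients `A 0, …, A n` with respect to
`x = x o` and `y = y o`. -/
def HasCoeffs (o : I) {n : ℕ} (f : HAlg I h) (A : Fin (n + 1) → HAlg I h) : Prop :=
  (∀ i, A i ∈ without h o) ∧
    f = ∑ i : Fin (n + 1),
      (n.choose i : ℂ) • (HAlg.x o ^ (n - (i : ℕ)) * HAlg.y o ^ (i : ℕ) * A i)

/-- `f` is an `n`-form with coefficients `A 0, …, A n`. -/
def IsForm (o : I) {n : ℕ} (f : HAlg I h) (A : Fin (n + 1) → HAlg I h) : Prop :=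
  f ≠ 0 ∧ IsInvariant f ∧ HasCoeffs o f A

/-- `d` is homogeneous of degree `n` in the indices `ι 0, …, ι (k - 1)`: a linear combination of
words in the generators in which each of these indices occurs exactly `n` times, and no other
index occurs. -/
def IsHomogeneousIn {k : ℕ} (ι : Fin k → I) (n : ℕ) (d : HAlg I h) : Prop :=
  d ∈ Submodule.span ℂ {a | ∃ w : List (Coord I),
    (∀ j, (w.map Coord.index).count (ι j) = n) ∧ (∀ c ∈ w, ∃ j, c.index = ι j) ∧
    a = (w.map HAlg.gen).prod}

/-- The ordered monomial `∏ j, x_j ^ (n - e j) * y_j ^ (e j)`. -/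
noncomputable def orderedMonomial {k n : ℕ} (ι : Fin k → I) (e : Fin k → Fin (n + 1)) :
    HAlg I h :=
  (List.ofFn fun j =>
    HAlg.x (h := h) (ι j) ^ (n - (e j : ℕ)) * HAlg.y (ι j) ^ (e j : ℕ)).prod

/-- The element
`(-1)^i x_j^i y_j^(n-i) + ∑ l = 1, …, i, γ i l * h^l * x_j^(i-l) y_j^(n-i+l)`. -/
noncomputable def powerCoeff (n : ℕ) (γ : ℕ → ℕ → ℂ) (j : I) (i : Fin (n + 1)) : HAlg I h :=
  (-1 : ℂ) ^ (i : ℕ) • (HAlg.x j ^ (i : ℕ) * HAlg.y j ^ (n - (i : ℕ))) +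
    ∑ l ∈ Finset.Icc 1 (i : ℕ), (γ i l * h ^ l) •
      (HAlg.x j ^ ((i : ℕ) - l) * HAlg.y j ^ (n - (i : ℕ) + l))

end Algebra

/-- The linear combination of the symbols `𝒜^(j)_0, …, 𝒜^(j)_n` that replaces
`x_j^i y_j^(n-i)`: the symbol `𝒜^(j)_i` replaces the expression `powerCoeff n γ j i`, and the
lower terms of the latter are replaced successively. -/
noncomputable def replacement (h : ℂ) {k n : ℕ} (γ : ℕ → ℕ → ℂ) (j : Fin k)
    (i : Fin (n + 1)) : FreeAlgebra ℂ (Fin k × Fin (n + 1)) :=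
  (-1 : ℂ) ^ (i : ℕ) • (FreeAlgebra.ι ℂ (j, i) -
    ∑ l : Fin (i : ℕ), (γ i ((l : ℕ) + 1) * h ^ ((l : ℕ) + 1)) •
      replacement h γ j ⟨(i : ℕ) - ((l : ℕ) + 1), by omega⟩)
termination_by (i : ℕ)
decreasing_by
  have := l.isLt
  omega

/-- The multilinear expression `∑ e, c e * A^(1)_(e 1) * ⋯ * A^(k)_(e k)`. -/
noncomputable def symbolSum {k n : ℕ} {B : Type*} [Ring B] [Algebra ℂ B]
    (c : (Fin k → Fin (n + 1)) → ℂ) (A : Fin k → Fin (n + 1) → B) : B :=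
  ∑ e : Fin k → Fin (n + 1), c e • (List.ofFn fun j => A j (e j)).prod

/-- `c` is the coefficient family that the symbolic replacement procedure yields for `d`:
write `(0 j)^n` as a form with coefficients `powerCoeff n γ j i`, write `d` as a linear
combination of ordered monomials, and replace in each ordered monomial the factor
`x_j^(n-i) y_j^i` by a linear combination of the symbols `𝒜^(j)_0, …, 𝒜^(j)_n`. -/
def IsSymbolicReplacement {I : Type*} [LinearOrder I] {h : ℂ} {k n : ℕ} (o : I) (ι : Fin k → I)
    (d : HAlg I h) (c : (Fin k → Fin (n + 1)) → ℂ) : Prop :=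
  ∃ (γ : ℕ → ℕ → ℂ) (p : (Fin k → Fin (n + 1)) → ℂ),
    (∀ j, HasCoeffs o (bracket (h := h) o (ι j) ^ n) (powerCoeff n γ (ι j))) ∧
    d = ∑ e : Fin k → Fin (n + 1), p e • orderedMonomial ι e ∧
    symbolSum c (fun j i => FreeAlgebra.ι ℂ (j, i)) =
      ∑ e : Fin k → Fin (n + 1),
        p e • (List.ofFn fun j => replacement h γ j (Fin.rev (e j))).prod

end NCForms

/-! The key is that $E$, $F$ and $H$ act on the coefficients of all invariant $f$ by matrices that
do not depend on $f$. Let $T$ be one of them, a skew derivation with twists $e^{sF}$ and $e^{tF}$,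
and put $m_i = x^{n-i}y^i$. Expanding $T f = 0$ gives $\sum\binom ni e^{sF}(m_i)\,T(A_i) =
-\sum\binom ni T(m_i)\,e^{tF}(A_i)$. Comparing coefficients expresses the $T(A_i)$ through the
$e^{tF}(A_i)$, and these through the $A_i$, because $e^{tF}f = f$ (`exists_expF_matrix`,
`IsSkew.exists_matrix`). Hence $T$ turns $\sum c_e A^{(1)}_{e_1}\cdots A^{(k)}_{e_k}$ into an
expression of the same kind whose coefficient family $c'$ depends on $c$ alone
(`IsSkew.exists_symbolSum`). For the forms $(0j)^n$ the result is $T d = 0$. The products of their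
coefficients are linearly independent (`symbolSum_injective`), so $c' = 0$. This $c'$ also computes
$T(\mathcal I)$, where all $k$ families are the coefficients of one form.

Comparison of coefficients needs the ordered monomials to be linearly independent. For this, $H_I$
acts on the commutative polynomial ring by $y_i \mapsto Y_i$ and $x_i \mapsto X_i + Y_iD$ with a
diagonal derivation $D$, and the value on $1$ determines an element (`symbol_injective`).

The procedure can be carried out because the spans of $x_i, y_i$ commute as subspaces, so that $d$
is a combination of ordered monomials (`IsHomogeneousIn.exists_monomials`), and because the
coefficients of $(0j)^n$ are triangular in the monomials (`exists_powerCoeff`), which `replacement`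
inverts (`lift_replacement`). -/

namespace NCForms

/-! ### Skew derivations on products of stable subspaces -/

section SubmoduleProducts

variable {R B : Type*} [CommRing R] [Ring B] [Algebra R B]

theorem map_list_prod_le (σ : B →ₐ[R] B) (L : List (Submodule R B))
    (hσ : ∀ V ∈ L, ∀ a ∈ V, σ a ∈ V) : ∀ a ∈ L.prod, σ a ∈ L.prod := by
  induction L with
  | nil =>
    intro a ha
    obtain ⟨z, rfl⟩ := Submodule.mem_one.1 ha
    simp
  | cons V L ih =>
    have hV := hσ V (by simp)
    have hL := ih fun W hW => hσ W (by simp [hW])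
    intro a ha
    rw [List.prod_cons] at ha ⊢
    induction ha using Submodule.mul_induction_on' with
    | mem_mul_mem a ha b hb =>
      rw [map_mul]
      exact Submodule.mul_mem_mul (hV a ha) (hL b hb)
    | add a _ b _ ha hb => rw [map_add]; exact add_mem ha hb

/-- Applied both to powers of a plane in $H_I$ and, in an algebra of $H_I$-valued functions, to
spans of form coefficients. -/
theorem skewDerivation_list_prod (T : B →ₗ[R] B) (σ τ : B →ₐ[R] B)
    (hT : ∀ a b, T (a * b) = T a * τ b + σ a * T b) (h1 : T 1 = 0) (L : List (Submodule R B))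
    (hL : ∀ V ∈ L, ∀ a ∈ V, T a ∈ V ∧ σ a ∈ V ∧ τ a ∈ V) : ∀ a ∈ L.prod, T a ∈ L.prod := by
  induction L with
  | nil =>
    intro a ha
    obtain ⟨z, rfl⟩ := Submodule.mem_one.1 (by simpa using ha)
    simp [Algebra.algebraMap_eq_smul_one, h1]
  | cons V L ih =>
    have hV := hL V (by simp)
    have hL' : ∀ W ∈ L, ∀ a ∈ W, T a ∈ W ∧ σ a ∈ W ∧ τ a ∈ W := fun W hW => hL W (by simp [hW])
    have hτ := map_list_prod_le τ L fun W hW a ha => (hL' W hW a ha).2.2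
    intro a ha
    rw [List.prod_cons] at ha ⊢
    induction ha using Submodule.mul_induction_on' with
    | mem_mul_mem a ha b hb =>
      rw [hT]
      exact add_mem (Submodule.mul_mem_mul (hV a ha).1 (hτ b hb))
        (Submodule.mul_mem_mul (hV a ha).2.1 (ih hL' b hb))
    | add a _ b _ ha hb => rw [map_add]; exact add_mem ha hb

end SubmoduleProducts

/-! ### Multilinear expressions as elements of products of spans -/

section SymbolSum

variable {B : Type*} [Ring B] [Algebra ℂ B] {k n : ℕ}

theorem symbolSum_succ (c : (Fin (k + 1) → Fin (n + 1)) → ℂ)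
    (A : Fin (k + 1) → Fin (n + 1) → B) :
    symbolSum c A =
      ∑ i, A 0 i * symbolSum (fun e => c (Fin.cons i e)) (fun j => A j.succ) := by
  unfold symbolSum
  rw [← (Fin.consEquiv fun _ => Fin (n + 1)).sum_comp, Fintype.sum_prod_type]
  refine Finset.sum_congr rfl fun i _ => ?_
  rw [Finset.mul_sum]
  refine Finset.sum_congr rfl fun e _ => ?_
  simp [Fin.consEquiv, List.ofFn_succ]

theorem map_symbolSum {B' : Type*} [Ring B'] [Algebra ℂ B'] (φ : B →ₐ[ℂ] B')
    (c : (Fin k → Fin (n + 1)) → ℂ) (A : Fin k → Fin (n + 1) → B) :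
    φ (symbolSum c A) = symbolSum c fun j i => φ (A j i) := by
  simp [symbolSum, map_sum, map_list_prod, List.map_ofFn, Function.comp_def]

/-- Reduces the existence of a coefficient family to membership in a product of subspaces, where
closure arguments apply. -/
theorem mem_prod_span_iff (A : Fin k → Fin (n + 1) → B) (a : B) :
    a ∈ (List.ofFn fun j => Submodule.span ℂ (Set.range (A j))).prod ↔
      ∃ c, symbolSum c A = a := by
  have key : (List.ofFn fun j => Submodule.span ℂ (Set.range (A j))).prod =
      Submodule.span ℂ (Set.range fun e : Fin k → Fin (n + 1) =>
        (List.ofFn fun j => A j (e j)).prod) := by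
    induction k with
    | zero => simp [Submodule.one_eq_span]
    | succ k ih =>
      rw [List.ofFn_succ, List.prod_cons, ih, Submodule.span_mul_span]
      congr 1
      ext b
      simp only [Set.mem_mul, Set.mem_range, exists_exists_eq_and, List.ofFn_succ, List.prod_cons]
      constructor
      · rintro ⟨i, e, rfl⟩
        exact ⟨Fin.cons i e, by simp⟩
      · rintro ⟨e, rfl⟩
        exact ⟨e 0, fun j => e j.succ, rfl⟩
  rw [key, ← Fintype.range_linearCombination ℂ, LinearMap.mem_range]
  rfl

end SymbolSum

/-! ### The relations without case distinction on the order of the indices -/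

section Relations

variable {I : Type*} [LinearOrder I] {h : ℂ}

theorem HAlg.yy (i j : I) : HAlg.y (h := h) i * HAlg.y j = HAlg.y j * HAlg.y i := by
  rcases lt_trichotomy i j with hij | rfl | hij
  · exact (HAlg.satisfies.yjyi i j hij).symm
  · rfl
  · exact HAlg.satisfies.yjyi j i hij

theorem HAlg.xy (i j : I) : HAlg.x (h := h) i * HAlg.y j =
    HAlg.y j * HAlg.x i + h • (HAlg.y j * HAlg.y i) := by
  rcases lt_trichotomy i j with hij | rfl | hij
  · rw [HAlg.satisfies.yjxi i j hij, HAlg.yy j i]; module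
  · exact HAlg.satisfies.xy i
  · exact HAlg.satisfies.xjyi j i hij

theorem HAlg.xx (i j : I) : HAlg.x (h := h) j * HAlg.x i =
    HAlg.x i * HAlg.x j - h • (HAlg.x i * HAlg.y j) + h • (HAlg.y i * HAlg.x j) +
      h ^ 2 • (HAlg.y i * HAlg.y j) := by
  rcases lt_trichotomy i j with hij | rfl | hij
  · exact HAlg.satisfies.xjxi i j hij
  · rw [HAlg.xy]; module
  · rw [HAlg.satisfies.xjxi j i hij, HAlg.xy i j, HAlg.xy j i, HAlg.yy j i]; module

/-- The relations with the `y`'s sorted to the left, applied to a further factor. -/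
theorem HAlg.xy_mul (i j : I) (a : HAlg I h) : HAlg.x i * (HAlg.y j * a) =
    HAlg.y j * (HAlg.x i * a) + h • (HAlg.y j * (HAlg.y i * a)) := by
  rw [← mul_assoc, HAlg.xy]; simp [add_mul, mul_assoc]

/-- An induction principle for `H_I` that multiplies by generators from the left. -/
theorem HAlg.left_induction {P : HAlg I h → Prop} (one : P 1)
    (smul : ∀ (z : ℂ) a, P a → P (z • a)) (add : ∀ a b, P a → P b → P (a + b))
    (hx : ∀ i a, P a → P (HAlg.x i * a)) (hy : ∀ i a, P a → P (HAlg.y i * a))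
    (a : HAlg I h) : P a := by
  suffices H : ∀ b, P b → P (a * b) by simpa using H 1 one
  induction a using HAlg.induction with
  | scalar z => intro b hb; rw [← Algebra.smul_def]; exact smul z b hb
  | hx i => exact hx i
  | hy i => exact hy i
  | mul a b ha hb => intro c hc; rw [mul_assoc]; exact ha _ (hb _ hc)
  | add a b ha hb => intro c hc; rw [add_mul]; exact add _ _ (ha c hc) (hb c hc)

@[simp] theorem expF_x (t : ℂ) (i : I) :
    expF t (HAlg.x (h := h) i) = HAlg.x i + t • HAlg.y i := by simp [expF]

@[simp] theorem expF_y (t : ℂ) (i : I) : expF t (HAlg.y (h := h) i) = HAlg.y i := by simp [expF]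

theorem expF_expF (s t : ℂ) (a : HAlg I h) : expF s (expF t a) = expF (s + t) a := by
  induction a using HAlg.induction with
  | scalar z => simp
  | hx i => simp; module
  | hy i => simp
  | mul a b ha hb => simp [ha, hb]
  | add a b ha hb => simp [ha, hb]

end Relations

/-! ### Action on the commutative polynomial ring and injectivity of the symbol -/

section Model

open MvPolynomial in
/-- The derivation `x i ↦ -h x i`, `y i ↦ h y i` of the commutative polynomial ring. -/
noncomputable def polyD (I : Type*) (h : ℂ) :
    Derivation ℂ (MvPolynomial (Coord I) ℂ) (MvPolynomial (Coord I) ℂ) :=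
  MvPolynomial.mkDerivation ℂ (onCoord (fun i => -(h • X (Coord.x i))) fun i => h • X (Coord.y i))

@[simp] theorem polyD_x {I : Type*} {h : ℂ} (i : I) :
    polyD I h (MvPolynomial.X (Coord.x i)) = -(h • MvPolynomial.X (Coord.x i)) := by
  simp [polyD, onCoord]

@[simp] theorem polyD_y {I : Type*} {h : ℂ} (i : I) :
    polyD I h (MvPolynomial.X (Coord.y i)) = h • MvPolynomial.X (Coord.y i) := by
  simp [polyD, onCoord]

variable {I : Type*} [LinearOrder I] {h : ℂ}

open MvPolynomial in
theorem satisfies_polyEnd : Satisfies (I := I) h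
    (fun i => LinearMap.mulLeft ℂ (X (Coord.x i) : MvPolynomial (Coord I) ℂ) +
      LinearMap.mulLeft ℂ (X (Coord.y i)) * (polyD I h).toLinearMap)
    (fun i => (LinearMap.mulLeft ℂ (X (Coord.y i)) : Module.End ℂ (MvPolynomial (Coord I) ℂ))) := by
  constructor
  all_goals
    intros
    refine LinearMap.ext fun p => ?_
    simp [Derivation.leibniz, MvPolynomial.smul_eq_C_mul]
    try ring

/-- The representation of `H_I` on the commutative polynomial ring. -/
noncomputable def polyRep : HAlg I h →ₐ[ℂ] Module.End ℂ (MvPolynomial (Coord I) ℂ) :=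
  HAlg.lift _ _ satisfies_polyEnd

/-- The symbol of an element of `H_I`: its value on `1` in the polynomial representation. -/
noncomputable def symbol : HAlg I h →ₗ[ℂ] MvPolynomial (Coord I) ℂ :=
  (LinearMap.applyₗ 1).comp polyRep.toLinearMap

@[simp] theorem symbol_one : symbol (1 : HAlg I h) = 1 := by simp [symbol]

open MvPolynomial in
theorem symbol_x_mul (i : I) (a : HAlg I h) : symbol (HAlg.x i * a) =
    X (Coord.x i) * symbol a + X (Coord.y i) * polyD I h (symbol a) := by
  simp [symbol, polyRep]

open MvPolynomial in
theorem symbol_y_mul (i : I) (a : HAlg I h) :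
    symbol (HAlg.y i * a) = X (Coord.y i) * symbol a := by
  simp [symbol, polyRep]

/-- The operator on `H_I` that corresponds to `polyD`. -/
noncomputable def opD : HAlg I h →ₗ[ℂ] HAlg I h :=
  -h • ((expF (h / 2)).toLinearMap ∘ₗ opH ∘ₗ (expF (h / 2)).toLinearMap)

/-- Placing $e^{hF/2}$ on both sides of $H$ adds $h$ to each exponent: the right twist $-h$ becomes
$0$, the left twist $h$ becomes $2h$. -/
theorem opD_mul (a b : HAlg I h) : opD (a * b) = opD a * b + expF (2 * h) a * opD b := by
  simp only [opD, LinearMap.smul_apply, LinearMap.comp_apply, AlgHom.toLinearMap_apply, map_mul,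
    opH_mul, map_add, expF_expF]
  rw [show h / 2 + (-h + h / 2) = 0 by ring, show h / 2 + (h + h / 2) = 2 * h by ring, expF_zero]
  simp [smul_add]

theorem opD_x_mul (i : I) (a : HAlg I h) : opD (HAlg.x i * a) =
    HAlg.x i * opD a + (2 * h) • (HAlg.y i * opD a) - h • (HAlg.x i * a) := by
  have : opD (HAlg.x (h := h) i) = -h • HAlg.x i := by
    simp [opD, op_generators]
  rw [opD_mul, this]
  simp [add_mul]; module

theorem opD_y_mul (i : I) (a : HAlg I h) : opD (HAlg.y i * a) =
    HAlg.y i * opD a + h • (HAlg.y i * a) := by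
  have : opD (HAlg.y (h := h) i) = h • HAlg.y i := by
    simp [opD, op_generators]
  rw [opD_mul, this]
  simp; module

theorem opD_one : opD (1 : HAlg I h) = 0 := by simp [opD, op_one]

/-- Commuting operators on `H_I`, the counterparts of the multiplications by the variables. -/
noncomputable def varOp (h : ℂ) : Coord I → Module.End ℂ (HAlg I h)
  | .x i => LinearMap.mulLeft ℂ (HAlg.x i) - LinearMap.mulLeft ℂ (HAlg.y i) * opD
  | .y i => LinearMap.mulLeft ℂ (HAlg.y i)

/-- Solving $x_i = X_i + Y_iD$ for $X_i$ suggests the operators. Their commutativity is what lets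
the polynomial ring act on $H_I$. -/
theorem varOp_comm (c c' : Coord I) : varOp h c * varOp h c' = varOp h c' * varOp h c := by
  have yyl (i j : I) (a : HAlg I h) : HAlg.y i * (HAlg.y j * a) = HAlg.y j * (HAlg.y i * a) := by
    rw [← mul_assoc, HAlg.yy, mul_assoc]
  have xxl (i j : I) (a : HAlg I h) := congrArg (· * a) (HAlg.xx (h := h) i j)
  simp only [add_mul, sub_mul, mul_assoc, smul_mul_assoc] at xxl
  refine LinearMap.ext fun a => ?_
  rcases c with i | i <;> rcases c' with j | j
  · simp [varOp, mul_sub, opD_x_mul, opD_y_mul]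
    rw [xxl i j]
    simp only [HAlg.xy_mul, mul_add, mul_smul_comm, yyl j i]
    module
  · simp [varOp, mul_sub, opD_y_mul]
    simp only [HAlg.xy_mul, mul_add, mul_smul_comm, yyl j i]
    module
  · simp [varOp, mul_sub, opD_y_mul]
    simp only [HAlg.xy_mul, mul_add, mul_smul_comm, yyl j i]
    module
  · simp [varOp, yyl i j]

open scoped IsMulCommutative in
/-- The action of the commutative polynomial ring on `H_I`. -/
theorem exists_unsymbol : ∃ r : MvPolynomial (Coord I) ℂ →ₗ[ℂ] HAlg I h, r 1 = 1 ∧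
    ∀ c p, r (p * MvPolynomial.X c) = varOp h c (r p) := by
  have := Algebra.isMulCommutative_adjoin ℂ (s := Set.range (varOp (I := I) h)) (by
    rintro _ ⟨c, rfl⟩ _ ⟨c', rfl⟩; exact varOp_comm c c')
  let v (c : Coord I) : Algebra.adjoin ℂ (Set.range (varOp (I := I) h)) :=
    ⟨varOp h c, Algebra.subset_adjoin ⟨c, rfl⟩⟩
  let φ : MvPolynomial (Coord I) ℂ →ₐ[ℂ] Algebra.adjoin ℂ (Set.range (varOp (I := I) h)) :=
    MvPolynomial.aeval v
  refine ⟨(LinearMap.applyₗ 1).comp ((Subalgebra.val _).comp φ).toLinearMap, ?_, ?_⟩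
  · simp
  · intro c p
    have : φ (p * MvPolynomial.X c) = φ (MvPolynomial.X c) * φ p := by rw [mul_comm, map_mul]
    have h2 : ((φ (MvPolynomial.X c) : Algebra.adjoin ℂ (Set.range (varOp (I := I) h))) :
      Module.End ℂ (HAlg I h)) = varOp h c := by simp [φ, v]
    simp [this, h2]

/-- The map `r`, given by the action of polynomials on $1 \in H_I$, intertwines `polyD` with `opD`.
Therefore it sends $X_i p + Y_i D p$ to $x_i\,r(p)$, and it is a left inverse of `symbol`. -/
theorem symbol_injective : Function.Injective (symbol (I := I) (h := h)) := by
  obtain ⟨r, h1, hr⟩ := exists_unsymbol (I := I) (h := h)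
  have hC (z : ℂ) : r (MvPolynomial.C z) = z • 1 := by
    rw [← h1, ← map_smul, MvPolynomial.smul_eq_C_mul, mul_one]
  have hD (p) : r (polyD I h p) = opD (r p) := by
    induction p using MvPolynomial.induction_on with
    | C z => simp [hC, opD_one]
    | add p q hp hq => simp [hp, hq]
    | mul_X p c hp =>
      rcases c with i | i
      · simp only [Derivation.leibniz, polyD_x, smul_eq_mul, map_add, hr]
        rw [mul_neg, mul_smul_comm, map_neg, map_smul, hr, mul_comm, hr, hp]
        simp [varOp, opD_x_mul, opD_y_mul]
        module
      · simp only [Derivation.leibniz, polyD_y, smul_eq_mul, map_add, hr]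
        rw [mul_smul_comm, map_smul, hr, mul_comm, hr, hp]
        simp [varOp, opD_y_mul]
        module
  refine Function.LeftInverse.injective (g := r) fun a => ?_
  induction a using HAlg.left_induction with
  | one => simp [h1]
  | smul z a ha => simp [ha]
  | add a b ha hb => simp [ha, hb]
  | hx i a ha =>
    rw [symbol_x_mul, map_add, mul_comm, hr, mul_comm, hr, hD, ha]
    simp [varOp]
  | hy i a ha =>
    rw [symbol_y_mul, mul_comm, hr, ha]
    simp [varOp]

end Model
-- Linear independence of ordered monomials and uniqueness of coefficients
section Uniqueness

variable {I : Type*} [LinearOrder I] {h : ℂ}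

theorem y_mul_cancel (i : I) {a : HAlg I h} (ha : HAlg.y i * a = 0) : a = 0 := by
  apply symbol_injective
  have := congrArg symbol ha
  rw [symbol_y_mul, map_zero] at this
  simpa [MvPolynomial.X_ne_zero] using this

open MvPolynomial in
/-- The symbols of the elements of `without h o` do not involve the variables of index `o`. -/
theorem symbol_mem_supported {o : I} {b : HAlg I h} (hb : b ∈ without h o) :
    symbol b ∈ supported ℂ {c : Coord I | c.index ≠ o} := by
  -- The value on $1$ alone does not pass through products, so stability of the whole subring is
  -- proved.
  suffices H : ∀ p ∈ supported ℂ {c : Coord I | c.index ≠ o},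
      polyRep b p ∈ supported ℂ {c : Coord I | c.index ≠ o} from H 1 (one_mem _)
  have hX (c : Coord I) (hc : c.index ≠ o) :
      (X c : MvPolynomial (Coord I) ℂ) ∈ supported ℂ {c : Coord I | c.index ≠ o} :=
    Algebra.subset_adjoin ⟨c, hc, rfl⟩
  have hD : ∀ p ∈ supported ℂ {c : Coord I | c.index ≠ o},
      polyD I h p ∈ supported ℂ {c : Coord I | c.index ≠ o} := by
    intro p hp
    induction hp using Algebra.adjoin_induction with
    | mem p hp =>
      obtain ⟨c, hc, rfl⟩ := hp
      rcases c with i | i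
      · rw [polyD_x]; exact neg_mem (Subalgebra.smul_mem _ (hX _ hc) _)
      · rw [polyD_y]; exact Subalgebra.smul_mem _ (hX _ hc) _
    | algebraMap z => simp
    | add p q _ _ hp hq => rw [map_add]; exact add_mem hp hq
    | mul p q hp' hq' hp hq =>
      rw [Derivation.leibniz]
      exact add_mem (mul_mem hp' hq) (mul_mem hq' hp)
  induction hb using Algebra.adjoin_induction with
  | mem b hb =>
    obtain ⟨c, hc, rfl⟩ := hb
    intro p hp
    rcases c with i | i
    · have : polyRep (h := h) (HAlg.gen (Coord.x i)) p =
          X (Coord.x i) * p + X (Coord.y i) * polyD I h p := by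
        change polyRep (HAlg.x i) p = _
        simp [polyRep]
      rw [this]
      exact add_mem (mul_mem (hX _ hc) hp) (mul_mem (hX (.y i) hc) (hD p hp))
    · have : polyRep (h := h) (HAlg.gen (Coord.y i)) p = X (Coord.y i) * p := by
        change polyRep (HAlg.y i) p = _
        simp [polyRep]
      rw [this]
      exact mul_mem (hX (.y i) hc) hp
  | algebraMap z => intro p hp; simpa using Subalgebra.smul_mem _ hp z
  | add a b _ _ ha hb => intro p hp; simpa using add_mem (ha p hp) (hb p hp)
  | mul a b _ _ ha hb => intro p hp; simpa using ha _ (hb p hp)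

open Classical MvPolynomial in
/-- The specialization `x o ↦ 1`, `y o ↦ 0` of the polynomial ring. -/
noncomputable def specialize {I : Type*} (o : I) :
    MvPolynomial (Coord I) ℂ →ₐ[ℂ] MvPolynomial (Coord I) ℂ :=
  aeval fun c => if c.index = o then onCoord (fun _ => 1) (fun _ => 0) c else X c

theorem specialize_supported {I : Type*} {o : I} {p : MvPolynomial (Coord I) ℂ}
    (hp : p ∈ MvPolynomial.supported ℂ {c : Coord I | c.index ≠ o}) : specialize o p = p := by
  induction hp using Algebra.adjoin_induction with
  | mem p hp =>
    obtain ⟨c, hc, rfl⟩ := hp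
    replace hc : c.index ≠ o := hc
    simp [specialize, hc]
  | algebraMap z => simp
  | add p q _ _ hp hq => rw [map_add, hp, hq]
  | mul p q _ _ hp hq => rw [map_mul, hp, hq]

theorem specialize_x_add_mul (o : I) (t : ℂ) (a : HAlg I h) :
    specialize o (symbol ((HAlg.x o + t • HAlg.y o) * a)) = specialize o (symbol a) := by
  rw [add_mul, smul_mul_assoc, map_add, map_smul, symbol_x_mul, symbol_y_mul]
  simp [specialize, Coord.index, onCoord]

theorem specialize_y_mul (o : I) (a : HAlg I h) :
    specialize o (symbol (HAlg.y o * a)) = 0 := by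
  rw [symbol_y_mul]
  simp [specialize, Coord.index, onCoord]

theorem specialize_pow_mul (o : I) (t : ℂ) (m : ℕ) (a : HAlg I h) :
    specialize o (symbol ((HAlg.x o + t • HAlg.y o) ^ m * a)) = specialize o (symbol a) := by
  induction m with
  | zero => simp
  | succ m ih => rw [pow_succ', mul_assoc, specialize_x_add_mul, ih]

theorem x_add_pow_mul_y (o : I) (t : ℂ) (m : ℕ) :
    (HAlg.x (h := h) o + t • HAlg.y o) ^ m * HAlg.y o =
      HAlg.y o * (HAlg.x o + (t + h) • HAlg.y o) ^ m := by
  have h1 : (HAlg.x (h := h) o + t • HAlg.y o) * HAlg.y o =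
      HAlg.y o * (HAlg.x o + (t + h) • HAlg.y o) := by
    rw [add_mul, HAlg.xy]; simp [mul_add, add_smul]; abel
  have : SemiconjBy (HAlg.y (h := h) o) (HAlg.x o + (t + h) • HAlg.y o) (HAlg.x o + t • HAlg.y o) :=
    h1.symm
  exact (this.pow_right m).symm

/-- The specialization $x_o \mapsto 1$, $y_o \mapsto 0$ kills every term but the one with $i = 0$,
so `B 0` vanishes. From the rest one $y_o$ is pulled to the left and cancelled. Passing the powers
of $x_o + t y_o$, it changes $t$ into $t + h$, which is why $t$ is arbitrary. -/
theorem coeffs_eq_zero_of_shifted (o : I) (n : ℕ) (t : ℂ) (B : Fin (n + 1) → HAlg I h)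
    (hB : ∀ i, B i ∈ without h o)
    (hs : ∑ i : Fin (n + 1),
      (HAlg.x o + t • HAlg.y o) ^ (n - (i : ℕ)) * HAlg.y o ^ (i : ℕ) * B i = 0) : B = 0 := by
  induction n generalizing t with
  | zero =>
    ext i
    fin_cases i
    simpa using hs
  | succ n ih =>
    rw [Fin.sum_univ_succ] at hs
    simp only [Fin.val_zero, pow_zero, mul_one, tsub_zero, Fin.val_succ, Nat.add_sub_add_right,
      pow_succ'] at hs
    simp_rw [← mul_assoc, x_add_pow_mul_y, mul_assoc, ← Finset.mul_sum] at hs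
    have h0 : B 0 = 0 := by
      have := congrArg (fun a => specialize o (symbol a)) hs
      simp only [map_add, map_zero, specialize_y_mul, add_zero] at this
      rw [specialize_x_add_mul, specialize_pow_mul,
        specialize_supported (symbol_mem_supported (hB 0))] at this
      exact symbol_injective (by simpa using this)
    rw [h0, mul_zero, mul_zero, zero_add] at hs
    have := ih _ (fun i => B i.succ) (fun i => hB _) (by simpa [mul_assoc] using y_mul_cancel o hs)
    ext i
    induction i using Fin.cases with
    | zero => exact h0
    | succ i => exact congrFun this i

/-- The monomials `x o ^ (n - i) * y o ^ i` are right linearly independent over `without h o`. -/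
theorem coeffs_eq_zero {o : I} {n : ℕ} {B : Fin (n + 1) → HAlg I h}
    (hB : ∀ i, B i ∈ without h o)
    (hs : ∑ i : Fin (n + 1), HAlg.x o ^ (n - (i : ℕ)) * HAlg.y o ^ (i : ℕ) * B i = 0) : B = 0 :=
  coeffs_eq_zero_of_shifted o n 0 B hB (by simpa using hs)

theorem HasCoeffs.unique {o : I} {n : ℕ} {f : HAlg I h} {A B : Fin (n + 1) → HAlg I h}
    (hA : HasCoeffs o f A) (hB : HasCoeffs o f B) : A = B := by
  have := coeffs_eq_zero (o := o) (B := fun i => (n.choose i : ℂ) • (A i - B i))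
    (fun i => Subalgebra.smul_mem _ (sub_mem (hA.1 i) (hB.1 i)) _) (by
      simp only [mul_smul_comm, mul_sub, smul_sub, Finset.sum_sub_distrib]
      rw [← hA.2, ← hB.2, sub_self])
  ext i
  have hi := congrFun this i
  have hc : (n.choose i : ℂ) ≠ 0 := by
    exact_mod_cast (Nat.choose_pos (Nat.lt_succ_iff.1 i.isLt)).ne'
  simpa [hc, sub_eq_zero] using hi

theorem gen_mem_without {o : I} {c : Coord I} (hc : c.index ≠ o) :
    HAlg.gen c ∈ without h o := Algebra.subset_adjoin ⟨c, hc, rfl⟩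

theorem x_mem_without {o i : I} (hi : i ≠ o) : HAlg.x i ∈ without h o :=
  gen_mem_without (c := .x i) hi

theorem y_mem_without {o i : I} (hi : i ≠ o) : HAlg.y i ∈ without h o :=
  gen_mem_without (c := .y i) hi

theorem symbolSum_mem {k n : ℕ} {B : Type*} [Ring B] [Algebra ℂ B] (S : Subalgebra ℂ B)
    (c : (Fin k → Fin (n + 1)) → ℂ) {A : Fin k → Fin (n + 1) → B} (hA : ∀ j i, A j i ∈ S) :
    symbolSum c A ∈ S :=
  sum_mem fun e _ => S.smul_mem (S.list_prod_mem (by simp [List.mem_ofFn, hA])) _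

/-- The ordered monomials in distinct indices are linearly independent. -/
theorem symbolSum_monomials_eq_zero {k n : ℕ} {ι : Fin k → I} (hι : Function.Injective ι)
    {c : (Fin k → Fin (n + 1)) → ℂ}
    (hc : symbolSum c (fun j i => HAlg.x (h := h) (ι j) ^ (n - (i : ℕ)) * HAlg.y (ι j) ^ (i : ℕ))
      = 0) : c = 0 := by
  induction k with
  | zero =>
    ext e
    -- The empty product is $1$, so this case needs $1 \ne 0$ in $H_I$.
    have hn : Nontrivial (HAlg I h) := ⟨⟨0, 1, fun h01 => by
      simpa using congrArg (symbol (I := I) (h := h)) h01⟩⟩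
    simp [symbolSum] at hc
    exact (congrArg c (Subsingleton.elim _ _)).trans hc
  | succ k ih =>
    rw [symbolSum_succ] at hc
    -- The index `ι 0` plays the role of `o`: by injectivity the remaining factors do not involve
    -- it.
    have := coeffs_eq_zero (fun i => symbolSum_mem _ _ fun j i =>
      mul_mem (pow_mem (x_mem_without (hι.ne (Fin.succ_ne_zero j))) _)
        (pow_mem (y_mem_without (hι.ne (Fin.succ_ne_zero j))) _)) hc
    ext e
    have h2 := ih (ι := fun j => ι j.succ) (hι.comp (Fin.succ_injective k)) (congrFun this (e 0))
    simpa using congrFun h2 (Fin.tail e)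

/-- If the families `A j` span the spaces of monomials of degree `n` in `x (ι j)`, `y (ι j)`, then
their ordered products are linearly independent. -/
theorem symbolSum_injective {k n : ℕ} {ι : Fin k → I} (hι : Function.Injective ι)
    {A : Fin k → Fin (n + 1) → HAlg I h}
    (hA : ∀ j, Submodule.span ℂ (Set.range (A j)) = Submodule.span ℂ (Set.range
      fun i : Fin (n + 1) => HAlg.x (ι j) ^ (n - (i : ℕ)) * HAlg.y (ι j) ^ (i : ℕ)))
    {c c' : (Fin k → Fin (n + 1)) → ℂ} (hc : symbolSum c A = symbolSum c' A) : c = c' := by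
  set M : Fin k → Fin (n + 1) → HAlg I h :=
    fun j i => HAlg.x (ι j) ^ (n - (i : ℕ)) * HAlg.y (ι j) ^ (i : ℕ)
  let L (B : Fin k → Fin (n + 1) → HAlg I h) := Fintype.linearCombination ℂ
    (fun e : Fin k → Fin (n + 1) => (List.ofFn fun j => B j (e j)).prod)
  have hM : LinearMap.ker (L M) = ⊥ :=
    LinearMap.ker_eq_bot'.2 fun p hp => symbolSum_monomials_eq_zero hι hp
  have hr : LinearMap.range (L A) = LinearMap.range (L M) := by
    ext a
    rw [LinearMap.mem_range, LinearMap.mem_range]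
    exact (mem_prod_span_iff A a).symm.trans (by simp_rw [hA]; exact mem_prod_span_iff M a)
  -- `L A` and `L M` have the same finite-dimensional source and the same range, so the kernel of `L
  -- A` is zero like that of `L M`.
  have h1 := LinearMap.finrank_range_add_finrank_ker (L M)
  have h2 := LinearMap.finrank_range_add_finrank_ker (L A)
  rw [hM, finrank_bot] at h1
  rw [hr] at h2
  have h3 : LinearMap.ker (L A) = ⊥ := Submodule.finrank_eq_zero.1 (by omega)
  exact LinearMap.ker_eq_bot.1 h3 hc

end Uniqueness

/-! ### Commuting planes and spanning by ordered monomials -/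

section Spanning

variable {I : Type*} [LinearOrder I] {h : ℂ}

/-- The span of the two generators with index `i`. -/
noncomputable def plane (h : ℂ) (i : I) : Submodule ℂ (HAlg I h) :=
  Submodule.span ℂ {HAlg.x i, HAlg.y i}

theorem x_mem_plane (i : I) : HAlg.x i ∈ plane h i := Submodule.subset_span (by simp)

theorem y_mem_plane (i : I) : HAlg.y i ∈ plane h i := Submodule.subset_span (by simp)

theorem plane_mul_le (i j : I) : plane h i * plane h j ≤ plane h j * plane h i := by
  have xx := Submodule.mul_mem_mul (x_mem_plane (h := h) j) (x_mem_plane (h := h) i)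
  have xy := Submodule.mul_mem_mul (x_mem_plane (h := h) j) (y_mem_plane (h := h) i)
  have yx := Submodule.mul_mem_mul (y_mem_plane (h := h) j) (x_mem_plane (h := h) i)
  have yy := Submodule.mul_mem_mul (y_mem_plane (h := h) j) (y_mem_plane (h := h) i)
  conv_lhs => rw [plane, plane, Submodule.span_mul_span]
  rw [Submodule.span_le]
  rintro _ ⟨a, ha, b, hb, rfl⟩
  rcases ha with rfl | rfl <;> rcases hb with rfl | rfl
  · change HAlg.x i * HAlg.x j ∈ _
    rw [HAlg.xx j i]
    exact add_mem (add_mem (sub_mem xx (Submodule.smul_mem _ _ xy)) (Submodule.smul_mem _ _ yx))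
      (Submodule.smul_mem _ _ yy)
  · change HAlg.x i * HAlg.y j ∈ _
    rw [HAlg.xy i j]
    exact add_mem yx (Submodule.smul_mem _ _ yy)
  · change HAlg.y i * HAlg.x j ∈ _
    rw [eq_sub_of_add_eq (HAlg.xy j i).symm, HAlg.yy i j]
    exact sub_mem xy (Submodule.smul_mem _ _ yy)
  · change HAlg.y i * HAlg.y j ∈ _
    rw [HAlg.yy i j]
    exact yy

theorem plane_commute (i j : I) : Commute (plane h i) (plane h j) :=
  le_antisymm (plane_mul_le i j) (plane_mul_le j i)

theorem y_pow_mul_x (i : I) (m : ℕ) : HAlg.y (h := h) i ^ m * HAlg.x i =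
    HAlg.x i * HAlg.y i ^ m - (m * h) • HAlg.y i ^ (m + 1) := by
  induction m with
  | zero => simp
  | succ m ih =>
    rw [pow_succ', mul_assoc, ih, mul_sub, ← mul_assoc, eq_sub_of_add_eq (HAlg.xy i i).symm,
      mul_smul_comm, ← pow_succ', sub_mul, smul_mul_assoc, mul_assoc, ← pow_succ', mul_assoc,
      ← pow_succ', ← pow_succ']
    push_cast
    module

/-- Moving $x_i$ to the left past $y_i^m$ only costs a multiple of $y_i^{m+1}$, which is again an
ordered monomial. -/
theorem plane_pow (i : I) (n : ℕ) : plane h i ^ n = Submodule.span ℂ (Set.range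
    fun e : Fin (n + 1) => HAlg.x (h := h) i ^ (n - (e : ℕ)) * HAlg.y i ^ (e : ℕ)) := by
  apply le_antisymm
  · induction n with
    | zero => simp [Submodule.one_eq_span]
    | succ n ih =>
      rw [pow_succ]
      refine (mul_le_mul_left ih _).trans ?_
      have hmem (a b : ℕ) (hab : a + b = n + 1) : HAlg.x (h := h) i ^ a * HAlg.y i ^ b ∈
          Submodule.span ℂ (Set.range fun e : Fin (n + 1 + 1) =>
            HAlg.x (h := h) i ^ (n + 1 - (e : ℕ)) * HAlg.y i ^ (e : ℕ)) := by
        refine Submodule.subset_span ⟨⟨b, by omega⟩, ?_⟩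
        simp [show n + 1 - b = a by omega]
      conv_lhs => rw [plane, Submodule.span_mul_span]
      rw [Submodule.span_le]
      rintro _ ⟨_, ⟨e, rfl⟩, b, hb, rfl⟩
      have he := e.isLt
      rcases hb with rfl | rfl
      · change HAlg.x i ^ (n - (e : ℕ)) * HAlg.y i ^ (e : ℕ) * HAlg.x i ∈ _
        rw [mul_assoc, y_pow_mul_x, mul_sub, mul_smul_comm, ← mul_assoc, ← pow_succ]
        exact sub_mem (hmem _ _ (by omega)) (Submodule.smul_mem _ _ (hmem _ _ (by omega)))
      · change HAlg.x i ^ (n - (e : ℕ)) * HAlg.y i ^ (e : ℕ) * HAlg.y i ∈ _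
        rw [mul_assoc, ← pow_succ]
        exact hmem _ _ (by omega)
  · rw [Submodule.span_le]
    rintro _ ⟨e, rfl⟩
    have := Submodule.mul_mem_mul (Submodule.pow_mem_pow _ (x_mem_plane (h := h) i) (n - e))
      (Submodule.pow_mem_pow _ (y_mem_plane (h := h) i) e)
    rwa [← pow_add, Nat.sub_add_cancel (by omega)] at this

/-- A homogeneous element is a linear combination of ordered monomials. -/
theorem IsHomogeneousIn.exists_monomials {k n : ℕ} {ι : Fin k → I} (hι : Function.Injective ι)
    {d : HAlg I h} (hd : IsHomogeneousIn ι n d) :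
    ∃ p : (Fin k → Fin (n + 1)) → ℂ, d = ∑ e, p e • orderedMonomial ι e := by
  suffices H : d ∈ (List.ofFn fun j => plane h (ι j) ^ n).prod by
    simp_rw [plane_pow] at H
    obtain ⟨p, hp⟩ := (mem_prod_span_iff _ _).1 H
    exact ⟨p, hp.symm⟩
  refine Submodule.span_le.2 ?_ hd
  rintro _ ⟨w, hw, hw', rfl⟩
  have hmem : ∀ w : List (Coord I),
      (w.map HAlg.gen).prod ∈ ((w.map Coord.index).map (plane h)).prod := by
    intro w
    induction w with
    | nil => exact Submodule.one_le.1 le_rfl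
    | cons c w ih =>
      simp only [List.map_cons, List.prod_cons]
      refine Submodule.mul_mem_mul ?_ ih
      cases c
      · exact x_mem_plane _
      · exact y_mem_plane _
  -- The letters need not be sorted one by one: the word lies in the product of the planes of its
  -- letters, and that product may be permuted.
  have hperm : (w.map Coord.index).Perm (List.ofFn fun j => List.replicate n (ι j)).flatten := by
    rw [List.perm_iff_count]
    intro i
    rw [List.count_flatten, List.map_ofFn, List.sum_ofFn]
    simp only [Function.comp_apply, List.count_replicate]
    by_cases hi : ∃ j, ι j = i
    · obtain ⟨j, rfl⟩ := hi
      rw [hw j, Finset.sum_eq_single j (fun j' _ hj => by simp [hι.ne hj]) (by simp)]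
      simp
    · rw [List.count_eq_zero.2, Finset.sum_eq_zero]
      · intro j _
        simp [mt (Exists.intro j) hi]
      · intro hmem
        obtain ⟨c, hc, rfl⟩ := List.mem_map.1 hmem
        obtain ⟨j, hj⟩ := hw' c hc
        exact hi ⟨j, hj.symm⟩
  have := hmem w
  rw [(hperm.map (plane h)).prod_eq' (List.pairwise_map.2 (List.pairwise_of_forall
    fun i j => plane_commute i j))] at this
  simpa [List.map_flatten, List.prod_flatten, List.map_ofFn, Function.comp_def] using this

end Spanning
-- The coefficients of the powers of a bracket
section PowerCoefficients

variable {I : Type*} [LinearOrder I] {h : ℂ}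

/-- The span of the monomials of degree `m` in one pair of generators whose degree in `x` is less
than `c`. -/
noncomputable def lowerTerms (h : ℂ) (c m : ℕ) : Submodule ℂ (HAlg Unit h) :=
  Submodule.span ℂ {u | ∃ a b, a < c ∧ a + b = m ∧ u = HAlg.x () ^ a * HAlg.y () ^ b}

theorem monomial_mem_lowerTerms {c m a b : ℕ} (hac : a < c) (hab : a + b = m) :
    HAlg.x () ^ a * HAlg.y () ^ b ∈ lowerTerms h c m :=
  Submodule.subset_span ⟨a, b, hac, hab, rfl⟩

theorem lowerTerms_mono {c c' : ℕ} (hc : c ≤ c') (m : ℕ) : lowerTerms h c m ≤ lowerTerms h c' m :=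
  Submodule.span_mono fun _ ⟨a, b, hac, hab, hu⟩ => ⟨a, b, hac.trans_le hc, hab, hu⟩

theorem x_mul_mem_lowerTerms {c m : ℕ} {u : HAlg Unit h} (hu : u ∈ lowerTerms h c m) :
    HAlg.x () * u ∈ lowerTerms h (c + 1) (m + 1) := by
  induction hu using Submodule.span_induction with
  | mem u hu =>
    obtain ⟨a, b, hac, hab, rfl⟩ := hu
    rw [← mul_assoc, ← pow_succ']
    exact monomial_mem_lowerTerms (by omega) (by omega)
  | zero => simp
  | add u v _ _ hu hv => rw [mul_add]; exact add_mem hu hv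
  | smul z u _ hu => rw [mul_smul_comm]; exact Submodule.smul_mem _ _ hu

/-- In the leftmost factor $x + ty$, the $x$ raises both degrees by one, and the $y$ moves to the
right through $(x + ty)^c$, leaving $(x + (t-h)y)^c\,y$. Hence the induction runs over all `d` and
`t`. -/
theorem shifted_pow_sub_mem (c d : ℕ) (t : ℂ) :
    (HAlg.x () + t • HAlg.y ()) ^ c * HAlg.y () ^ d - HAlg.x () ^ c * HAlg.y () ^ d ∈
      lowerTerms h c (c + d) := by
  induction c generalizing d t with
  | zero => simp
  | succ c ih =>
    have h1 : (HAlg.x (h := h) () + t • HAlg.y ()) ^ (c + 1) * HAlg.y () ^ d -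
        HAlg.x () ^ (c + 1) * HAlg.y () ^ d =
        HAlg.x () * ((HAlg.x () + t • HAlg.y ()) ^ c * HAlg.y () ^ d -
          HAlg.x () ^ c * HAlg.y () ^ d) +
        t • (((HAlg.x () + (t - h) • HAlg.y ()) ^ c * HAlg.y () ^ (d + 1) -
          HAlg.x () ^ c * HAlg.y () ^ (d + 1)) + HAlg.x () ^ c * HAlg.y () ^ (d + 1)) := by
      have h2 := x_add_pow_mul_y (h := h) () (t - h) c
      rw [sub_add_cancel] at h2
      rw [sub_add_cancel, pow_succ' (HAlg.y ()) d, ← mul_assoc _ (HAlg.y ()), h2, pow_succ',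
        pow_succ']
      simp only [add_mul, mul_sub, smul_mul_assoc, mul_assoc]
      abel
    rw [h1]
    have h3 := ih (d + 1) (t - h)
    rw [show c + 1 + d = c + d + 1 by ring]
    refine add_mem (x_mul_mem_lowerTerms (ih d t)) (Submodule.smul_mem _ _ (add_mem ?_ ?_))
    · exact lowerTerms_mono (by omega) _ h3
    · exact monomial_mem_lowerTerms (by omega) (by omega)

theorem y_mul_monomial_sub_mem (c d : ℕ) :
    HAlg.y () * (HAlg.x () ^ c * HAlg.y () ^ d) - HAlg.x () ^ c * HAlg.y () ^ (d + 1) ∈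
      lowerTerms h c (c + d + 1) := by
  have h2 := x_add_pow_mul_y (h := h) () (-h) c
  rw [neg_add_cancel, zero_smul, add_zero] at h2
  rw [← mul_assoc, ← h2, mul_assoc, ← pow_succ']
  exact shifted_pow_sub_mem c (d + 1) (-h)

theorem y_mul_mem_lowerTerms {c m : ℕ} {u : HAlg Unit h} (hu : u ∈ lowerTerms h c m) :
    HAlg.y () * u ∈ lowerTerms h c (m + 1) := by
  induction hu using Submodule.span_induction with
  | mem u hu =>
    obtain ⟨a, b, hac, rfl, rfl⟩ := hu
    rw [← sub_add_cancel (HAlg.y () * _) (HAlg.x () ^ a * HAlg.y () ^ (b + 1))]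
    exact add_mem (lowerTerms_mono hac.le _ (y_mul_monomial_sub_mem a b))
      (monomial_mem_lowerTerms hac (by omega))
  | zero => simp
  | add u v _ _ hu hv => rw [mul_add]; exact add_mem hu hv
  | smul z u _ hu => rw [mul_smul_comm]; exact Submodule.smul_mem _ _ hu

theorem exists_sum_of_mem_lowerTerms {c m : ℕ} (hc : c ≤ m) {u : HAlg Unit h}
    (hu : u ∈ lowerTerms h c m) : ∃ g : ℕ → ℂ,
      u = ∑ l ∈ Finset.Icc 1 c, g l • (HAlg.x () ^ (c - l) * HAlg.y () ^ (m - c + l)) := by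
  induction hu using Submodule.span_induction with
  | mem u hu =>
    obtain ⟨a, b, hac, rfl, rfl⟩ := hu
    refine ⟨Pi.single (c - a) 1, ?_⟩
    rw [Finset.sum_eq_single (c - a)]
    · rw [show c - (c - a) = a by omega, show a + b - c + (c - a) = b by omega]
      simp
    · intro l _ hl
      simp [Pi.single_eq_of_ne hl]
    · intro hn
      simp at hn
      omega
  | zero => exact ⟨0, by simp⟩
  | add u v _ _ hu hv =>
    obtain ⟨g, rfl⟩ := hu
    obtain ⟨g', rfl⟩ := hv
    exact ⟨g + g', by simp [add_smul, Finset.sum_add_distrib]⟩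
  | smul z u _ hu =>
    obtain ⟨g, rfl⟩ := hu
    exact ⟨z • g, by simp [Finset.smul_sum, mul_smul]⟩

/-- The homomorphism that sends the single pair of generators to the pair with index `j`. -/
noncomputable def atIndex (j : I) : HAlg Unit h →ₐ[ℂ] HAlg I h :=
  HAlg.lift (fun _ => HAlg.x j) (fun _ => HAlg.y j)
    { xy := fun _ => HAlg.xy j j
      xjyi := fun _ _ hij => absurd hij (lt_irrefl _)
      yjxi := fun _ _ hij => absurd hij (lt_irrefl _)
      yjyi := fun _ _ hij => absurd hij (lt_irrefl _)
      xjxi := fun _ _ hij => absurd hij (lt_irrefl _) }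

@[simp] theorem atIndex_x (j : I) : atIndex j (HAlg.x (h := h) ()) = HAlg.x j := by simp [atIndex]

@[simp] theorem atIndex_y (j : I) : atIndex j (HAlg.y (h := h) ()) = HAlg.y j := by simp [atIndex]

theorem bracket_mul_x (o j : I) :
    bracket (h := h) o j * HAlg.x o = HAlg.x o * bracket o j := by
  have yyl (i j : I) (a : HAlg I h) : HAlg.y i * (HAlg.y j * a) = HAlg.y j * (HAlg.y i * a) := by
    rw [← mul_assoc, HAlg.yy, mul_assoc]
  simp only [bracket, sub_mul, mul_sub, smul_mul_assoc, mul_smul_comm, mul_assoc,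
    HAlg.xx o j, HAlg.xy_mul, mul_add, smul_add, HAlg.xy o j, yyl j o, HAlg.yy j o,
    smul_smul, add_mul]
  module

/-- Together with `bracket_mul_x` this sorts the product of a bracket with $x_o^a y_o^i$, the
letters of index `j` ending up on the right; it yields the recursion for the coefficients of the
powers. -/
theorem bracket_mul_y_pow (o j : I) (i : ℕ) : bracket (h := h) o j * HAlg.y o ^ i =
    HAlg.x o * HAlg.y o ^ i * HAlg.y j -
      HAlg.y o ^ (i + 1) * (HAlg.x j + ((i + 1 : ℕ) * h) • HAlg.y j) := by
  have hc (i : ℕ) : HAlg.y (h := h) j * HAlg.y o ^ i = HAlg.y o ^ i * HAlg.y j :=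
    ((show Commute (HAlg.y (h := h) j) (HAlg.y o) from HAlg.yy j o).pow_right i).eq
  have hx (i : ℕ) : HAlg.x (h := h) j * HAlg.y o ^ i =
      HAlg.y o ^ i * (HAlg.x j + (i * h) • HAlg.y j) := by
    induction i with
    | zero => simp
    | succ i ih =>
      rw [pow_succ, ← mul_assoc, ih, mul_assoc, mul_assoc, add_mul, HAlg.xy, smul_mul_assoc,
        HAlg.yy j o]
      push_cast
      simp only [mul_add, mul_smul_comm]
      module
  rw [bracket, sub_mul, sub_mul, mul_assoc, hc, mul_assoc, hx, smul_mul_assoc, mul_assoc, hc,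
    pow_succ']
  push_cast
  simp only [mul_add, mul_smul_comm, mul_assoc]
  module

/-- The coefficients of the powers of the brackets, with their leading terms. -/
theorem exists_bracket_pow_coeffs (I : Type*) [LinearOrder I] (h : ℂ) (m : ℕ) :
    ∃ a : ℕ → HAlg Unit h,
      (∀ i ≤ m, a i - (-1 : ℂ) ^ i • (HAlg.x () ^ i * HAlg.y () ^ (m - i)) ∈ lowerTerms h i m) ∧
      ∀ o j : I, bracket (h := h) o j ^ m = ∑ i ∈ Finset.range (m + 1),
        (m.choose i : ℂ) • (HAlg.x o ^ (m - i) * HAlg.y o ^ i * atIndex j (a i)) := by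
  induction m with
  | zero => exact ⟨fun _ => 1, by simp, by simp⟩
  | succ m ih =>
    obtain ⟨a, ha, hb⟩ := ih
    -- Two terms contribute to $x_o^{m-i}y_o^{i+1}$: the $(i+1)$-st through $x_o y_j$ and the $i$-th
    -- through $y_o x_j$ and its correction. The inverse binomial restores the normalization.
    let a' : ℕ → HAlg Unit h
      | 0 => HAlg.y () * a 0
      | i + 1 => ((m + 1).choose (i + 1) : ℂ)⁻¹ • ((m.choose (i + 1) : ℂ) • (HAlg.y () * a (i + 1)) -
          (m.choose i : ℂ) • ((HAlg.x () + ((i + 1 : ℕ) * h) • HAlg.y ()) * a i))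
    have hchoose (i : ℕ) (hi : i ≤ m) : ((m + 1).choose (i + 1) : ℂ) ≠ 0 := by
      exact_mod_cast (Nat.choose_pos (by omega)).ne'
    refine ⟨a', ?_, ?_⟩
    · have hy (i : ℕ) (hi : i ≤ m) : HAlg.y () * a i -
          (-1 : ℂ) ^ i • (HAlg.x () ^ i * HAlg.y () ^ (m + 1 - i)) ∈ lowerTerms h i (m + 1) := by
        have h1 := y_mul_mem_lowerTerms (ha i hi)
        have h2 := Submodule.smul_mem _ ((-1 : ℂ) ^ i) (y_mul_monomial_sub_mem (h := h) i (m - i))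
        rw [show i + (m - i) + 1 = m + 1 by omega, show m - i + 1 = m + 1 - i by omega] at h2
        have h3 := add_mem h1 h2
        rw [mul_sub, mul_smul_comm, smul_sub, sub_add_sub_cancel] at h3
        exact h3
      intro i hi
      rcases i with _ | i
      · exact hy 0 (by omega)
      · have hi' : i ≤ m := by omega
        have e1 : (m.choose (i + 1) : ℂ) • (HAlg.y () * a (i + 1) -
            (-1 : ℂ) ^ (i + 1) • (HAlg.x () ^ (i + 1) * HAlg.y () ^ (m + 1 - (i + 1)))) ∈
            lowerTerms h (i + 1) (m + 1) := by
          -- For $i = m$ nothing is known about `a (m + 1)`, but its factor $\binom m{m+1}$ is zero.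
          rcases hi'.lt_or_eq with hlt | rfl
          · exact Submodule.smul_mem _ _ (hy (i + 1) hlt)
          · simp
        have e2 := x_mul_mem_lowerTerms (ha i hi')
        have e3 : HAlg.y () * a i ∈ lowerTerms h (i + 1) (m + 1) := by
          have := add_mem (lowerTerms_mono (Nat.le_succ i) _ (hy i hi')) (Submodule.smul_mem _
            ((-1 : ℂ) ^ i) (monomial_mem_lowerTerms (h := h) (a := i) (b := m + 1 - i)
              (Nat.lt_succ_self i) (by omega)))
          rwa [sub_add_cancel] at this
        have e4 := Submodule.smul_mem _ ((m + 1).choose (i + 1) : ℂ)⁻¹ (sub_mem e1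
          (Submodule.smul_mem _ (m.choose i : ℂ) (add_mem e2
            (Submodule.smul_mem _ ((i + 1 : ℕ) * h) e3))))
        convert e4 using 1
        rw [Nat.add_sub_add_right, ← sub_eq_zero]
        -- Pascal's rule adds the two leading terms up to
        -- $(-1)^{i+1}\binom{m+1}{i+1}x^{i+1}y^{m-i}$.
        have hp : ((m + 1).choose (i + 1) : ℂ) = m.choose i + m.choose (i + 1) := by
          rw [Nat.choose_succ_succ]; push_cast; rfl
        have hne := hchoose i hi'
        have hx : HAlg.x (h := h) () * HAlg.x () ^ i = HAlg.x () ^ (i + 1) := (pow_succ' _ _).symm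
        simp only [a', mul_sub, mul_smul_comm, add_mul, smul_mul_assoc, ← mul_assoc, hx]
        rw [← smul_right_injective _ hne |>.eq_iff]
        simp only [smul_sub, smul_add, smul_inv_smul₀ hne, smul_zero, pow_succ]
        rw [hp]
        module
    · intro o j
      rw [pow_succ', hb, Finset.mul_sum, Finset.sum_range_succ' _ (m + 1)]
      have hcomm (i : ℕ) : bracket (h := h) o j * HAlg.x o ^ i = HAlg.x o ^ i * bracket o j :=
        ((show Commute (bracket (h := h) o j) (HAlg.x o) from bracket_mul_x o j).pow_right i).eq
      let g (i : ℕ) : HAlg I h := (m.choose i : ℂ) •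
        (HAlg.x o ^ (m + 1 - i) * HAlg.y o ^ i * (HAlg.y j * atIndex j (a i)))
      -- The index shift brings in `g (m + 1)`, which is zero because $\binom m{m+1} = 0$.
      have hg : ∑ i ∈ Finset.range (m + 1), g i =
          ∑ i ∈ Finset.range (m + 1), g (i + 1) + g 0 := by
        rw [← Finset.sum_range_succ', Finset.sum_range_succ _ (m + 1)]
        simp [g]
      have h0 : (((m + 1).choose 0 : ℕ) : ℂ) • (HAlg.x o ^ (m + 1 - 0) * HAlg.y o ^ 0 *
          atIndex j (a' 0)) = g 0 := by
        simp [g, a']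
      rw [h0]
      have hl : ∀ i ∈ Finset.range (m + 1), bracket o j * ((m.choose i : ℂ) •
          (HAlg.x o ^ (m - i) * HAlg.y o ^ i * atIndex j (a i))) =
          g i - (m.choose i : ℂ) • (HAlg.x o ^ (m - i) * HAlg.y o ^ (i + 1) *
            ((HAlg.x j + ((i + 1 : ℕ) * h) • HAlg.y j) * atIndex j (a i))) := by
        intro i hi
        have hi' := Finset.mem_range.1 hi
        rw [mul_smul_comm, ← mul_assoc, ← mul_assoc, hcomm, mul_assoc (HAlg.x o ^ _),
          bracket_mul_y_pow, mul_sub, sub_mul, smul_sub]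
        simp only [g, ← mul_assoc, ← pow_succ, show m - i + 1 = m + 1 - i by omega]
      rw [Finset.sum_congr rfl hl, Finset.sum_sub_distrib, hg, add_sub_right_comm,
        ← Finset.sum_sub_distrib]
      congr 1
      refine Finset.sum_congr rfl fun i hi => ?_
      have hne := hchoose i (Nat.lt_succ_iff.1 (Finset.mem_range.1 hi))
      simp only [a', g, map_smul, map_sub, map_mul, map_add, atIndex_x, atIndex_y, mul_smul_comm,
        smul_inv_smul₀ hne, mul_sub, smul_sub, Nat.add_sub_add_right]

/-- The coefficients of the forms `(0 j)^n` have the shape used in the symbolic method. -/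
theorem exists_powerCoeff (hh : h ≠ 0) (n : ℕ) : ∃ γ : ℕ → ℕ → ℂ, ∀ o j : I, j ≠ o →
    HasCoeffs o (bracket (h := h) o j ^ n) (powerCoeff n γ j) := by
  -- The elements `a i` live over a one-point index set and reach index `j` through `atIndex`, so
  -- the numbers read off from them are the same for all `o` and `j`.
  obtain ⟨a, ha, hb⟩ := exists_bracket_pow_coeffs I h n
  have hex (i : ℕ) : ∃ g : ℕ → ℂ, i ≤ n →
      a i - (-1 : ℂ) ^ i • (HAlg.x () ^ i * HAlg.y () ^ (n - i)) =
      ∑ l ∈ Finset.Icc 1 i, g l • (HAlg.x () ^ (i - l) * HAlg.y () ^ (n - i + l)) := by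
    by_cases hi : i ≤ n
    · obtain ⟨g, hg⟩ := exists_sum_of_mem_lowerTerms hi (ha i hi)
      exact ⟨g, fun _ => hg⟩
    · exact ⟨0, fun h => absurd h hi⟩
  choose g hg using hex
  -- Extracting the factor $h^l$ from the numbers is where $h \ne 0$ enters.
  refine ⟨fun i l => g i l / h ^ l, fun o j hj => ⟨fun i => ?_, ?_⟩⟩
  · have hm (a b : ℕ) : HAlg.x (h := h) j ^ a * HAlg.y j ^ b ∈ without h o :=
      mul_mem (pow_mem (x_mem_without hj) _) (pow_mem (y_mem_without hj) _)
    exact add_mem (Subalgebra.smul_mem _ (hm _ _) _)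
      (sum_mem fun l _ => Subalgebra.smul_mem _ (hm _ _) _)
  · rw [hb, Finset.sum_range]
    refine Finset.sum_congr rfl fun i _ => ?_
    rw [eq_add_of_sub_eq' (hg i (Nat.lt_succ_iff.1 i.isLt))]
    congr 2
    simp [powerCoeff, map_sum, div_mul_cancel₀ _ (pow_ne_zero _ hh)]

end PowerCoefficients

/-! ### The replacement procedure inverts a triangular system -/

section Replacement

variable {I : Type*} [LinearOrder I] {h : ℂ} {k n : ℕ}

theorem replacement_mem_span (γ : ℕ → ℕ → ℂ) (j : Fin k) (i : Fin (n + 1)) :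
    replacement h γ j i ∈
      Submodule.span ℂ (Set.range fun i : Fin (n + 1) => FreeAlgebra.ι ℂ (j, i)) := by
  obtain ⟨i, hi⟩ := i
  induction i using Nat.strong_induction_on with
  | _ i ih =>
    rw [replacement]
    exact Submodule.smul_mem _ _ (sub_mem (Submodule.subset_span ⟨_, rfl⟩)
      (sum_mem fun l _ => Submodule.smul_mem _ _ (ih _ (Nat.sub_lt_of_pos_le l.val.succ_pos l.isLt) _)))

/-- `replacement` solves the triangular system for the monomials by back substitution, so evaluating
the symbols returns the monomial. -/
theorem lift_replacement (γ : ℕ → ℕ → ℂ) (ι : Fin k → I) (j : Fin k) (i : Fin (n + 1)) :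
    FreeAlgebra.lift ℂ (fun q : Fin k × Fin (n + 1) => powerCoeff (h := h) n γ (ι q.1) q.2)
      (replacement h γ j i) = HAlg.x (ι j) ^ (i : ℕ) * HAlg.y (ι j) ^ (n - (i : ℕ)) := by
  obtain ⟨i, hi⟩ := i
  induction i using Nat.strong_induction_on with
  | _ i ih =>
    rw [replacement]
    simp only [map_smul, map_sub, map_sum, FreeAlgebra.lift_ι_apply]
    have : ∑ l : Fin i, (γ i (l + 1) * h ^ ((l : ℕ) + 1)) •
        FreeAlgebra.lift ℂ (fun q : Fin k × Fin (n + 1) => powerCoeff (h := h) n γ (ι q.1) q.2)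
          (replacement h γ j ⟨i - ((l : ℕ) + 1), by omega⟩) =
        ∑ l ∈ Finset.Icc 1 i, (γ i l * h ^ l) •
          (HAlg.x (ι j) ^ (i - l) * HAlg.y (ι j) ^ (n - i + l)) := by
      rw [← Finset.Ico_add_one_right_eq_Icc, Finset.sum_Ico_eq_sum_range, Finset.sum_range]
      refine Finset.sum_congr (by simp) fun l _ => ?_
      have hl : (l : ℕ) < i := by simp
      rw [ih _ (by omega) _]
      simp only [add_comm 1 (l : ℕ)]
      rw [show n - (i - ((l : ℕ) + 1)) = n - i + (l + 1) by omega]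
    rw [this]
    simp only [powerCoeff, add_sub_cancel_right, smul_smul, ← mul_pow]
    simp

theorem span_powerCoeff (γ : ℕ → ℕ → ℂ) (j : I) :
    Submodule.span ℂ (Set.range (powerCoeff (h := h) n γ j)) = Submodule.span ℂ (Set.range
      fun i : Fin (n + 1) => HAlg.x j ^ (n - (i : ℕ)) * HAlg.y j ^ (i : ℕ)) := by
  apply le_antisymm <;> rw [Submodule.span_le] <;> rintro _ ⟨i, rfl⟩
  · have hm (a b : ℕ) (hab : a + b = n) : HAlg.x (h := h) j ^ a * HAlg.y j ^ b ∈
        Submodule.span ℂ (Set.range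
          fun i : Fin (n + 1) => HAlg.x (h := h) j ^ (n - (i : ℕ)) * HAlg.y j ^ (i : ℕ)) := by
      refine Submodule.subset_span ⟨⟨b, by omega⟩, ?_⟩
      simp [show n - b = a by omega]
    exact add_mem (Submodule.smul_mem _ _ (hm _ _ (by omega)))
      (sum_mem fun l hl => Submodule.smul_mem _ _ (hm _ _ (by simp at hl; omega)))
  -- A monomial is the value of a `replacement`, a combination of symbols; one slot (`Fin 1`)
  -- suffices here.
  · have h1 := Submodule.mem_map_of_mem (f := (FreeAlgebra.lift ℂ
      (fun q : Fin 1 × Fin (n + 1) => powerCoeff (h := h) n γ j q.2)).toLinearMap)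
      (replacement_mem_span (h := h) γ (0 : Fin 1) (Fin.rev i))
    rw [Submodule.map_span, ← Set.range_comp] at h1
    have h2 := lift_replacement (h := h) γ (fun _ : Fin 1 => j) 0 (Fin.rev i)
    simp only [Fin.val_rev, Nat.reduceSubDiff] at h2
    rw [show n - (n - (i : ℕ)) = i by omega] at h2
    change HAlg.x j ^ (n - (i : ℕ)) * HAlg.y j ^ (i : ℕ) ∈ _
    rw [← h2]
    simpa [Function.comp_def] using h1

end Replacement
-- Action of the operators on the coefficients of invariant forms
section Equivariance

variable {I : Type*} [LinearOrder I] {h : ℂ}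

/-- A skew derivation with respect to `expF s` and `expF t` that preserves the planes spanned by
the pairs of generators. -/
structure IsSkew (T : HAlg I h →ₗ[ℂ] HAlg I h) (s t : ℂ) : Prop where
  map_one : T 1 = 0
  map_mul (a b) : T (a * b) = T a * expF t b + expF s a * T b
  map_x (i) : T (HAlg.x i) ∈ plane h i
  map_y (i) : T (HAlg.y i) ∈ plane h i

theorem isSkew_opE : IsSkew (opE (I := I) (h := h)) h (-h) where
  map_one := op_one.1
  map_mul := opE_mul
  map_x i := by rw [(op_generators i).1]; exact zero_mem _
  map_y i := by rw [(op_generators i).2.1]; exact x_mem_plane i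

theorem isSkew_opF : IsSkew (opF (I := I) (h := h)) 0 0 where
  map_one := op_one.2.1
  map_mul a b := by rw [opF_mul, expF_zero, expF_zero]
  map_x i := by rw [(op_generators i).2.2.1]; exact y_mem_plane i
  map_y i := by rw [(op_generators i).2.2.2.1]; exact zero_mem _

theorem isSkew_opH : IsSkew (opH (I := I) (h := h)) h (-h) where
  map_one := op_one.2.2
  map_mul := opH_mul
  map_x i := by rw [(op_generators i).2.2.2.2.1]; exact x_mem_plane i
  map_y i := by rw [(op_generators i).2.2.2.2.2]; exact neg_mem (y_mem_plane i)

theorem map_mem_plane {T : HAlg I h →ₗ[ℂ] HAlg I h} {i : I} (hx : T (HAlg.x i) ∈ plane h i)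
    (hy : T (HAlg.y i) ∈ plane h i) {a : HAlg I h} (ha : a ∈ plane h i) : T a ∈ plane h i := by
  have : plane h i ≤ (plane h i).comap T := by
    conv_lhs => rw [plane]
    rw [Submodule.span_le]
    rintro _ (rfl | rfl)
    · exact hx
    · exact hy
  exact this ha

theorem expF_mem_plane (t : ℂ) {i : I} {a : HAlg I h} (ha : a ∈ plane h i) :
    expF t a ∈ plane h i :=
  map_mem_plane (T := (expF t).toLinearMap)
    (by simpa using add_mem (x_mem_plane i) (Submodule.smul_mem _ t (y_mem_plane i)))
    (by simpa using y_mem_plane i) ha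

theorem expF_mem_plane_pow (t : ℂ) {i : I} {n : ℕ} {a : HAlg I h} (ha : a ∈ plane h i ^ n) :
    expF t a ∈ plane h i ^ n := by
  rw [← List.prod_replicate] at ha ⊢
  refine map_list_prod_le (expF t) _ (fun V hV a ha => ?_) a ha
  obtain rfl := List.eq_of_mem_replicate hV
  exact expF_mem_plane t ha

theorem IsSkew.mem_plane_pow {T : HAlg I h →ₗ[ℂ] HAlg I h} {s t : ℂ} (hT : IsSkew T s t) {i : I}
    {n : ℕ} {a : HAlg I h} (ha : a ∈ plane h i ^ n) : T a ∈ plane h i ^ n := by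
  rw [← List.prod_replicate] at ha ⊢
  refine skewDerivation_list_prod T (expF s) (expF t) hT.map_mul hT.map_one _
    (fun V hV a ha => ?_) a ha
  obtain rfl := List.eq_of_mem_replicate hV
  exact ⟨map_mem_plane (hT.map_x i) (hT.map_y i) ha, expF_mem_plane s ha, expF_mem_plane t ha⟩

theorem plane_le_without {o i : I} (hi : i ≠ o) {a : HAlg I h} (ha : a ∈ plane h i) :
    a ∈ without h o := by
  have : plane h i ≤ Subalgebra.toSubmodule (without h o) := by
    rw [plane, Submodule.span_le]
    rintro _ (rfl | rfl)
    · exact x_mem_without hi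
    · exact y_mem_without hi
  exact this ha

theorem gen_mem_plane (c : Coord I) : HAlg.gen c ∈ plane h c.index := by
  cases c
  · exact x_mem_plane _
  · exact y_mem_plane _

theorem expF_mem_without (t : ℂ) {o : I} {a : HAlg I h} (ha : a ∈ without h o) :
    expF t a ∈ without h o := by
  induction ha using Algebra.adjoin_induction with
  | mem a ha =>
    obtain ⟨c, hc, rfl⟩ := ha
    exact plane_le_without hc (expF_mem_plane t (gen_mem_plane c))
  | algebraMap z => simp
  | add a b _ _ ha hb => rw [map_add]; exact add_mem ha hb
  | mul a b _ _ ha hb => rw [map_mul]; exact mul_mem ha hb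

theorem IsSkew.mem_without {T : HAlg I h →ₗ[ℂ] HAlg I h} {s t : ℂ} (hT : IsSkew T s t) {o : I}
    {a : HAlg I h} (ha : a ∈ without h o) : T a ∈ without h o := by
  induction ha using Algebra.adjoin_induction with
  | mem a ha =>
    obtain ⟨c, hc, rfl⟩ := ha
    exact plane_le_without hc (map_mem_plane (hT.map_x _) (hT.map_y _) (gen_mem_plane c))
  | algebraMap z => simp [Algebra.algebraMap_eq_smul_one, hT.map_one]
  | add a b _ _ ha hb => rw [map_add]; exact add_mem ha hb
  | mul a b ha' hb' ha hb =>
    rw [hT.map_mul]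
    exact add_mem (mul_mem ha (expF_mem_without t hb')) (mul_mem (expF_mem_without s ha') hb)

/-- Only the constant term of the exponential series survives. -/
theorem expF_eq_self {f : HAlg I h} (hf : opF f = 0) (t : ℂ) : expF t f = f := by
  obtain ⟨N, hN⟩ := expF_eq_sum t f
  rw [hN (N + 1) (by omega), Finset.sum_range_succ', Finset.sum_eq_zero]
  · simp
  · intro m _
    rw [Function.iterate_succ_apply, hf, ← Module.End.coe_pow, map_zero, smul_zero]

theorem monomial_mem_plane_pow (i : I) {n : ℕ} (e : Fin (n + 1)) :
    HAlg.x i ^ (n - (e : ℕ)) * HAlg.y i ^ (e : ℕ) ∈ plane h i ^ n := by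
  rw [plane_pow]
  exact Submodule.subset_span ⟨e, rfl⟩

/-- Comparison of coefficients with respect to the shifted monomials. -/
theorem exists_compare_coeffs (s : ℂ) (o : I) {n : ℕ} {u : Fin (n + 1) → HAlg I h}
    (hu : ∀ i, u i ∈ plane h o ^ n) : ∃ M : Fin (n + 1) → Fin (n + 1) → ℂ,
    ∀ A B : Fin (n + 1) → HAlg I h, (∀ i, A i ∈ without h o) → (∀ i, B i ∈ without h o) →
      ∑ i : Fin (n + 1), (n.choose i : ℂ) •
        (expF s (HAlg.x o ^ (n - (i : ℕ)) * HAlg.y o ^ (i : ℕ)) * B i) =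
      ∑ i : Fin (n + 1), (n.choose i : ℂ) • (u i * A i) →
      ∀ j, B j = ∑ i, M j i • A i := by
  -- The shifted monomials also span: expand $e^{-sF}(u_i)$ in ordinary monomials and apply
  -- $e^{sF}$.
  have hw (i : Fin (n + 1)) : ∃ w : Fin (n + 1) → ℂ,
      u i = ∑ j : Fin (n + 1), w j • expF s (HAlg.x o ^ (n - (j : ℕ)) * HAlg.y o ^ (j : ℕ)) := by
    have h1 := expF_mem_plane_pow (-s) (hu i)
    rw [plane_pow, Submodule.mem_span_range_iff_exists_fun] at h1
    obtain ⟨w, hw⟩ := h1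
    refine ⟨w, ?_⟩
    have h2 := congrArg (expF s) hw
    rw [expF_expF, add_neg_cancel, expF_zero] at h2
    simpa [map_sum] using h2.symm
  choose w hw using hw
  refine ⟨fun j i => (n.choose j : ℂ)⁻¹ * (n.choose i * w i j), fun A B hA hB hAB j => ?_⟩
  have hD : ∀ j : Fin (n + 1), (n.choose j : ℂ) • B j - ∑ i : Fin (n + 1), (n.choose i * w i j) • A i ∈
      without h o := fun j =>
    sub_mem (Subalgebra.smul_mem _ (hB j) _) (sum_mem fun i _ => Subalgebra.smul_mem _ (hA i) _)
  -- Applying $e^{-sF}$ turns the shifted monomials into ordinary ones, whose right independence is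
  -- known.
  have hz := coeffs_eq_zero (fun j => expF_mem_without (-s) (hD j)) (by
    have h0 : ∑ j : Fin (n + 1), expF s (HAlg.x o ^ (n - (j : ℕ)) * HAlg.y o ^ (j : ℕ)) *
        ((n.choose j : ℂ) • B j - ∑ i : Fin (n + 1), (n.choose i * w i j) • A i) = 0 := by
      simp only [mul_sub, Finset.sum_sub_distrib, mul_smul_comm, Finset.mul_sum]
      rw [hAB, Finset.sum_comm, sub_eq_zero]
      refine Finset.sum_congr rfl fun i _ => ?_
      rw [hw i, Finset.sum_mul, Finset.smul_sum]
      refine Finset.sum_congr rfl fun j _ => ?_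
      rw [smul_mul_assoc, smul_smul]
    have h1 := congrArg (expF (-s)) h0
    rw [map_sum, map_zero] at h1
    rw [← h1]
    refine Finset.sum_congr rfl fun j _ => ?_
    rw [map_mul (expF (-s)), expF_expF, neg_add_cancel, expF_zero])
  have hj := congrArg (expF s) (congrFun hz j)
  rw [expF_expF, add_neg_cancel, expF_zero, Pi.zero_apply, map_zero, sub_eq_zero] at hj
  have hc : (n.choose j : ℂ) ≠ 0 := by
    exact_mod_cast (Nat.choose_pos (Nat.lt_succ_iff.1 j.isLt)).ne'
  simp_rw [mul_smul, ← Finset.smul_sum]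
  rw [eq_inv_smul_iff₀ hc, hj]
  simp_rw [mul_smul]

/-- The operators `expF t` act on the coefficients of all forms by a common matrix. -/
theorem exists_expF_matrix (t : ℂ) (o : I) (n : ℕ) : ∃ M : Fin (n + 1) → Fin (n + 1) → ℂ,
    ∀ (f : HAlg I h) (A : Fin (n + 1) → HAlg I h), IsInvariant f → HasCoeffs o f A →
      ∀ j, expF t (A j) = ∑ i, M j i • A i := by
  obtain ⟨M, hM⟩ := exists_compare_coeffs (h := h) t o (monomial_mem_plane_pow (n := n) o)
  refine ⟨M, fun f A hf hA => hM A _ hA.1 (fun i => expF_mem_without t (hA.1 i)) ?_⟩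
  -- Here $u_i$ is the $i$-th monomial itself, and the two sides are the expansions of $e^{tF}f$ and
  -- $f$.
  rw [← hA.2]
  conv_rhs => rw [← expF_eq_self hf.2.1 t, hA.2]
  simp

/-- A skew derivation acts on the coefficients of all forms that it annihilates by a common
matrix. -/
theorem IsSkew.exists_matrix {T : HAlg I h →ₗ[ℂ] HAlg I h} {s t : ℂ} (hT : IsSkew T s t)
    (hinv : ∀ f, IsInvariant f → T f = 0) (o : I) (n : ℕ) :
    ∃ M : Fin (n + 1) → Fin (n + 1) → ℂ,
      ∀ (f : HAlg I h) (A : Fin (n + 1) → HAlg I h), IsInvariant f → HasCoeffs o f A →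
        ∀ j, T (A j) = ∑ i, M j i • A i := by
  obtain ⟨N, hN⟩ := exists_expF_matrix (h := h) t o n
  -- With $u_i = -T(m_i)$ the comparison expresses $T(A_j)$ through the $e^{tF}(A_i)$; `N` then
  -- passes to the $A_i$.
  obtain ⟨M, hM⟩ := exists_compare_coeffs (h := h) s o fun i : Fin (n + 1) =>
    neg_mem (hT.mem_plane_pow (monomial_mem_plane_pow o i))
  refine ⟨fun j i => ∑ l, M j l * N l i, fun f A hf hA j => ?_⟩
  rw [hM (fun i => expF t (A i)) (fun i => T (A i)) (fun i => expF_mem_without t (hA.1 i))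
    (fun i => hT.mem_without (hA.1 i)) ?_ j]
  · simp_rw [hN f A hf hA, Finset.smul_sum, Finset.sum_smul, smul_smul]
    exact Finset.sum_comm
  · have h0 := hinv f hf
    rw [hA.2, map_sum] at h0
    rw [← sub_eq_zero, ← Finset.sum_sub_distrib, ← h0]
    refine Finset.sum_congr rfl fun i _ => ?_
    rw [map_smul, hT.map_mul _ (A i), ← smul_sub, neg_mul, sub_neg_eq_add, add_comm (_ * T (A i))]

/-- A skew derivation acts on the multilinear expressions in the coefficients of forms through the
coefficient families of these expressions. -/
theorem IsSkew.exists_symbolSum {T : HAlg I h →ₗ[ℂ] HAlg I h} {s t : ℂ} (hT : IsSkew T s t)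
    (hinv : ∀ f, IsInvariant f → T f = 0) (o : I) {k n : ℕ} (c : (Fin k → Fin (n + 1)) → ℂ) :
    ∃ c' : (Fin k → Fin (n + 1)) → ℂ, ∀ A : Fin k → Fin (n + 1) → HAlg I h,
      (∀ j, ∃ f, IsInvariant f ∧ HasCoeffs o f (A j)) → T (symbolSum c A) = symbolSum c' A := by
  -- Arguing in the algebra of functions on the set of all admissible families produces one `c'`
  -- valid for all of them at once; `v j i` is the universal coefficient.
  let Ω := {A : Fin k → Fin (n + 1) → HAlg I h // ∀ j, ∃ f, IsInvariant f ∧ HasCoeffs o f (A j)}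
  let v (j : Fin k) (i : Fin (n + 1)) : Ω → HAlg I h := fun ω => ω.1 j i
  have key (S : HAlg I h →ₗ[ℂ] HAlg I h) (hS : ∃ M : Fin (n + 1) → Fin (n + 1) → ℂ,
      ∀ (f : HAlg I h) (A : Fin (n + 1) → HAlg I h), IsInvariant f → HasCoeffs o f A →
        ∀ j, S (A j) = ∑ i, M j i • A i) (j : Fin k) :
      ∀ a ∈ Submodule.span ℂ (Set.range (v j)),
        S.compLeft Ω a ∈ Submodule.span ℂ (Set.range (v j)) := by
    obtain ⟨M, hM⟩ := hS
    suffices H : Submodule.span ℂ (Set.range (v j)) ≤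
        (Submodule.span ℂ (Set.range (v j))).comap (S.compLeft Ω) from fun a ha => H ha
    rw [Submodule.span_le]
    rintro _ ⟨i, rfl⟩
    have : S.compLeft Ω (v j i) = ∑ l, M i l • v j l := by
      ext ω
      obtain ⟨f, hf, hA⟩ := ω.2 j
      simpa [v] using hM f _ hf hA i
    change S.compLeft Ω (v j i) ∈ Submodule.span ℂ (Set.range (v j))
    rw [this]
    exact sum_mem fun l _ => Submodule.smul_mem _ _ (Submodule.subset_span ⟨l, rfl⟩)
  have hprod := skewDerivation_list_prod (T.compLeft Ω) ((expF s).compLeft Ω)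
    ((expF t).compLeft Ω) (fun a b => by ext ω; exact hT.map_mul _ _)
    (by ext ω; exact hT.map_one) (List.ofFn fun j => Submodule.span ℂ (Set.range (v j))) (by
      intro V hV a ha
      obtain ⟨j, rfl⟩ := List.mem_ofFn.1 hV
      exact ⟨key T (hT.exists_matrix hinv o n) j a ha,
        key (expF s).toLinearMap (exists_expF_matrix s o n) j a ha,
        key (expF t).toLinearMap (exists_expF_matrix t o n) j a ha⟩)
    (symbolSum c v) ((mem_prod_span_iff v _).2 ⟨c, rfl⟩)
  obtain ⟨c', hc'⟩ := (mem_prod_span_iff v _).1 hprod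
  refine ⟨c', fun A hA => ?_⟩
  have heval (c : (Fin k → Fin (n + 1)) → ℂ) : symbolSum c v ⟨A, hA⟩ = symbolSum c A :=
    map_symbolSum (Pi.evalAlgHom ℂ (fun _ : Ω => HAlg I h) ⟨A, hA⟩) c v
  rw [← heval, ← heval, hc']
  rfl

theorem IsInvariant.one : IsInvariant (1 : HAlg I h) := op_one

theorem IsInvariant.mul {a b : HAlg I h} (ha : IsInvariant a) (hb : IsInvariant b) :
    IsInvariant (a * b) := by
  refine ⟨?_, ?_, ?_⟩
  · rw [opE_mul, ha.1, hb.1]; simp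
  · rw [opF_mul, ha.2.1, hb.2.1]; simp
  · rw [opH_mul, ha.2.2, hb.2.2]; simp

theorem IsInvariant.pow {a : HAlg I h} (ha : IsInvariant a) (n : ℕ) : IsInvariant (a ^ n) := by
  induction n with
  | zero => rw [pow_zero]; exact .one
  | succ n ih => rw [pow_succ]; exact ih.mul ha

theorem isInvariant_bracket (i j : I) : IsInvariant (bracket (h := h) i j) := by
  have hi := op_generators (h := h) i
  have hj := op_generators (h := h) j
  refine ⟨?_, ?_, ?_⟩
  · simp only [bracket, map_sub, map_smul, opE_mul, hi, hj, expF_x, expF_y]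
    simp only [zero_mul, mul_zero, add_mul, mul_add, smul_mul_assoc, mul_smul_comm]
    module
  · simp only [bracket, map_sub, map_smul, opF_mul, hi, hj]
    simp
  · simp only [bracket, map_sub, map_smul, opH_mul, hi, hj, expF_x, expF_y]
    simp only [mul_neg, neg_mul, add_mul, mul_add, smul_mul_assoc, mul_smul_comm]
    module

end Equivariance

end NCForms

/-! ### The symbolic method -/

open NCForms in
theorem theorem9 {I : Type*} [LinearOrder I] (h : ℂ) (hh : h ≠ 0) (o : I) (n k : ℕ)
    (ι : Fin k → I) (hι : StrictMono ι) (hιo : ∀ j, ι j ≠ o)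
    (d : NCForms.HAlg I h) (hd : NCForms.IsInvariant d)
    (hdeg : NCForms.IsHomogeneousIn ι n d) :
    ∃ c : (Fin k → Fin (n + 1)) → ℂ,
      NCForms.IsSymbolicReplacement o ι d c ∧
      (∀ c' : (Fin k → Fin (n + 1)) → ℂ, NCForms.IsSymbolicReplacement o ι d c' → c' = c) ∧
      (∀ A : Fin k → Fin (n + 1) → NCForms.HAlg I h,
        (∀ j, NCForms.HasCoeffs o (NCForms.bracket o (ι j) ^ n) (A j)) →
          d = NCForms.symbolSum c A) ∧
      ∀ (f : NCForms.HAlg I h) (A : Fin (n + 1) → NCForms.HAlg I h), NCForms.IsForm o f A →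
        NCForms.symbolSum c (fun _ : Fin k => A) ∈ NCForms.without h o ∧
        NCForms.IsInvariant (NCForms.symbolSum c (fun _ : Fin k => A)) := by
  obtain ⟨γ, hγ⟩ := exists_powerCoeff (I := I) hh n
  obtain ⟨p, hp⟩ := hdeg.exists_monomials hι.injective
  have hsum : ∀ c, IsSymbolicReplacement o ι d c →
      ∀ A : Fin k → Fin (n + 1) → HAlg I h,
        (∀ j, HasCoeffs o (bracket o (ι j) ^ n) (A j)) → d = symbolSum c A := by
    rintro c ⟨γ', p', hγ', hp', hc⟩ A hA
    -- Coefficients are unique, so `A` may be evaluated with the `γ'` of the procedure, whichever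
    -- numbers it used.
    obtain rfl : A = fun j => powerCoeff n γ' (ι j) := funext fun j => (hA j).unique (hγ' j)
    have := congrArg (FreeAlgebra.lift ℂ
      (fun q : Fin k × Fin (n + 1) => powerCoeff (h := h) n γ' (ι q.1) q.2)) hc
    rw [map_symbolSum] at this
    simp only [FreeAlgebra.lift_ι_apply] at this
    rw [this, hp', map_sum]
    refine Finset.sum_congr rfl fun e _ => ?_
    rw [map_smul, map_list_prod, List.map_ofFn]
    refine congrArg (fun a => p' e • (List.ofFn a).prod) (funext fun j => ?_)
    rw [Function.comp_apply, lift_replacement, Fin.val_rev, Nat.add_sub_add_right,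
      Nat.sub_sub_self (Nat.lt_succ_iff.1 (e j).isLt)]
  have hinj {c c' : (Fin k → Fin (n + 1)) → ℂ}
      (hcc : symbolSum c (fun j => powerCoeff (h := h) n γ (ι j)) =
        symbolSum c' fun j => powerCoeff n γ (ι j)) : c = c' :=
    symbolSum_injective hι.injective (fun j => span_powerCoeff γ (ι j)) hcc
  obtain ⟨c, hc⟩ : ∃ c, IsSymbolicReplacement o ι d c := by
    have hmem : ∑ e : Fin k → Fin (n + 1),
        p e • (List.ofFn fun j => replacement h γ j (Fin.rev (e j))).prod ∈
        (List.ofFn fun j : Fin k => Submodule.span ℂ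
          (Set.range fun i : Fin (n + 1) => FreeAlgebra.ι ℂ (j, i))).prod := by
      refine sum_mem fun e _ => Submodule.smul_mem _ _ ?_
      have hlist {k : ℕ} {B : Type} [Ring B] [Algebra ℂ B] (a : Fin k → B)
          (V : Fin k → Submodule ℂ B) (ha : ∀ j, a j ∈ V j) :
          (List.ofFn a).prod ∈ (List.ofFn V).prod := by
        induction k with
        | zero => simp only [List.ofFn_zero, List.prod_nil]; exact Submodule.one_le.1 le_rfl
        | succ k ih =>
          rw [List.ofFn_succ, List.ofFn_succ, List.prod_cons, List.prod_cons]
          exact Submodule.mul_mem_mul (ha 0) (ih _ _ fun j => ha j.succ)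
      exact hlist _ _ fun j => replacement_mem_span γ j _
    obtain ⟨c, hc⟩ := (mem_prod_span_iff (fun (j : Fin k) (i : Fin (n + 1)) =>
      FreeAlgebra.ι ℂ (j, i)) _).1 hmem
    exact ⟨c, γ, p, fun j => hγ o (ι j) (hιo j), hp, hc⟩
  have hdc := hsum c hc _ fun j => hγ o (ι j) (hιo j)
  -- Two outcomes of the procedure, even with different `γ` and `p`, both represent `d` in the same
  -- independent products.
  refine ⟨c, hc, fun c' hc' => hinj ?_, hsum c hc, fun f A hf => ⟨?_, ?_⟩⟩
  · rw [← hsum c' hc' _ fun j => hγ o (ι j) (hιo j), hdc]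
  · exact symbolSum_mem _ _ fun _ i => hf.2.2.1 i
  · have key {T : HAlg I h →ₗ[ℂ] HAlg I h} {s t : ℂ} (hT : IsSkew T s t)
        (hinv : ∀ f, IsInvariant f → T f = 0) : T (symbolSum c fun _ : Fin k => A) = 0 := by
      obtain ⟨c', hc'⟩ := hT.exists_symbolSum hinv o c
      -- On the coefficients of the $(0j)^n$ the expression is `d`, which `T` kills; independence
      -- gives `c' = 0`, and this is then used for `f`.
      have h0 := hc' _ fun j => ⟨_, (isInvariant_bracket o (ι j)).pow n, hγ o (ι j) (hιo j)⟩
      rw [← hdc, hinv d hd] at h0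
      have hz : c' = 0 := hinj (h0.symm.trans (by simp [symbolSum]))
      rw [hc' _ fun _ => ⟨f, hf.2.1, hf.2.2⟩, hz]
      simp [symbolSum]
    exact ⟨key isSkew_opE fun f hf => hf.1, key isSkew_opF fun f hf => hf.2.1,
      key isSkew_opH fun f hf => hf.2.2⟩
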